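/- Let $l^2$ have the canonical basis $(e_k)_{k\ge 0}$, let $U e_k=e_{k+1}$ be the unilateral shift, $K e_k=k e_k$, and let $\mathfrak T$ be the Toeplitz algebra, i.e. the unital $C^*$-algebra generated by $U$. Let $A,B:\mathbb Z_{\ge0}\to(0,\infty)$ be such that $\sum_{k\ge 0}A(k)^{-1}<\infty$, $B$ is increasing (not necessarily strictly), and $\lim_{k\to\infty}B(k)=1$. A distribution is a formal series $$a=\sum_{n\ge1}f_n(K)(U^*)^n+\sum_{n\ge0}U^n g_n(K)$$ with arbitrary $f_n,g_n:\mathbb Z_{\ge 0}\to\mathbb C$ (equivalently, an arbitrary infinite matrix $(a_{ij})_{i,j\ge0}$, with $f_n(k)=a_{k,k+n}$ and $g_n(k)=a_{k+n,k}$). Let $L^2_A(\mathfrak T)$ be the Hilbert space of the distributions of finite norm for the inner product $$(a,b)_A=\mathrm{Tr}\left(A(K)^{-1}ba^*\right)=\sum_{i,j}A(i)^{-1}\,b_{ij}\,\overline{a_{ij}},$$ which is the completion of $\mathfrak T$ for this inner product. On distributions put $$D(a)=A(K)[UB(K),a],\qquad \bar D(a)=A(K)[B(K)U^*,a],$$ and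 let $\mathrm{Dom}_{max}(D)=\{a\in L^2_A(\mathfrak T): D(a)\in L^2_A(\mathfrak T)\}$, and similarly for $\bar D$. When the limits $f_n^b=\lim_{k\to\infty} f_n(k)$ and $g_n^b=\lim_{k\to\infty} g_n(k)$ exist, the boundary value of $a$ is $$r(a)=\sum_{n\ge1}f_n^b e^{-in\phi}+\sum_{n\ge0}g_n^b e^{in\phi}.$$ For $N\in\mathbb Z$ let $P_N$ be the orthogonal projection in $L^2(S^1)$ onto the closed span of $\{e^{in\phi}: n\le N\}$, and let $D_{P_N}$ be the operator $D$ in $L^2_A(\mathfrak T)$ with the domain $$\mathrm{dom}(D_{P_N})=\{a\in\mathrm{Dom}_{max}(D): r(a)\in\mathrm{Ran}\,P_N\}$$ (the condition means that $r(a)$ exists, is the Fourier series of a function in $L^2(S^1)$, and this function lies in $\mathrm{Ran}\,P_N$; similarly below). Then, for every $N\in\mathbb Z$: 1. $D_{P_N}$ is an unbounded Fredholm operator: it is densely defined and closed, its kernel is finite dimensional, and its range is closed and of finite codimension. 2. The Hilbert space adjoint $D_{P_N}^*$ is the operator $\bar D$ with the domain $$\mathrm{dom}(D_{P_N}^*)=\{a\in\mathrm{Dom}_{max}(\bar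 D): e^{-i\phi}r(a)\in\mathrm{Ker}\,P_N\}.$$ 3. $\mathrm{Ind}\,D_{P_N}=\dim\mathrm{Ker}\,D_{P_N}-\dim\mathrm{Coker}\,D_{P_N}=N+1$. -/

import Mathlib

open Filter Topology MeasureTheory ComplexConjugate
open scoped ENNReal Real

noncomputable section

namespace QuantumDisk

/-! ### Unbounded Fredholm operators -/

/-- A linear operator `T` defined on a subspace of a Hilbert space `H` is an (unbounded) Fredholm
operator if it is densely defined and closed, its kernel is finite dimensional, and its range is
closed and of finite codimension. -/
structure IsFredholm {H : Type*} [NormedAddCommGroup H] [InnerProductSpace ℂ H]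
    (T : H →ₗ.[ℂ] H) : Prop where
  dense_domain : Dense (T.domain : Set H)
  isClosed : T.IsClosed
  finite_ker : FiniteDimensional ℂ (LinearMap.ker T.toFun)
  isClosed_range : IsClosed (LinearMap.range T.toFun : Set H)
  finite_coker : FiniteDimensional ℂ (H ⧸ LinearMap.range T.toFun)

/-- The Fredholm index `dim Ker T - dim Coker T`. -/
def index {H : Type*} [NormedAddCommGroup H] [InnerProductSpace ℂ H] (T : H →ₗ.[ℂ] H) : ℤ :=
  (Module.finrank ℂ (LinearMap.ker T.toFun) : ℤ) -
    (Module.finrank ℂ (H ⧸ LinearMap.range T.toFun) : ℤ)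

/-! ### Distributions on the quantum disk -/

/-- A distribution is a formal series `∑_{n ≥ 1} f_n(K) (U*)^n + ∑_{n ≥ 0} U^n g_n(K)` with
arbitrary coefficients `f_n, g_n : ℕ → ℂ`. Since `f_n(K) (U*)^n` has the entries `f_n(k)` in the
places `(k, k + n)`, and `U^n g_n(K)` the entries `g_n(k)` in the places `(k + n, k)`, and no
others, such series are the same as arbitrary infinite matrices (with respect to the canonical
basis `e_0, e_1, …` of `l²`): the coefficients are read off the diagonals, see `fCoeff` and
`gCoeff`. -/
abbrev Distribution : Type := Matrix ℕ ℕ ℂ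

/-- The coefficient function `f_n` of a distribution. For `n = 0` it agrees with `g_0`. -/
def fCoeff (a : Distribution) (n k : ℕ) : ℂ := a k (k + n)

/-- The coefficient function `g_n` of a distribution. -/
def gCoeff (a : Distribution) (n k : ℕ) : ℂ := a (k + n) k

/-- The product of infinite matrices. Below one of the factors always has at most one nonzero
entry in each row and in each column, so that all the sums have at most one nonzero term. -/
def prod (a b : Distribution) : Distribution := fun i j => ∑' k, a i k * b k j

/-- The unilateral shift `U e_k = e_{k+1}`. -/
def U : Distribution := fun i j => if i = j + 1 then 1 else 0

/-- The adjoint `U*` of the unilateral shift. -/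
def Ustar : Distribution := fun i j => if i + 1 = j then 1 else 0

/-- The operator `f(K)`, where `K e_k = k e_k`. -/
def funK (f : ℕ → ℝ) : Distribution := fun i j => if i = j then (f i : ℂ) else 0

/-- The commutator `[a, b] = a b - b a`. -/
def comm (a b : Distribution) : Distribution := prod a b - prod b a

/-- `D(a) = A(K) [U B(K), a]`. -/
def D (A B : ℕ → ℝ) (a : Distribution) : Distribution :=
  prod (funK A) (comm (prod U (funK B)) a)

/-- `D̄(a) = A(K) [B(K) U*, a]`. -/
def Dbar (A B : ℕ → ℝ) (a : Distribution) : Distribution :=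
  prod (funK A) (comm (prod (funK B) Ustar) a)

theorem funK_prod (f : ℕ → ℝ) (a : Distribution) (i j : ℕ) :
    prod (funK f) a i j = f i * a i j := by
  rw [prod, tsum_eq_single i]
  · simp [funK]
  · intro k hk
    simp [funK, Ne.symm hk]

theorem prod_funK (f : ℕ → ℝ) (a : Distribution) (i j : ℕ) :
    prod a (funK f) i j = a i j * f j := by
  rw [prod, tsum_eq_single j]
  · simp [funK]
  · intro k hk
    simp [funK, hk]

theorem UB_prod_zero (B : ℕ → ℝ) (a : Distribution) (j : ℕ) :
    prod (prod U (funK B)) a 0 j = 0 := by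
  simp [prod, U, funK]

theorem UB_prod_succ (B : ℕ → ℝ) (a : Distribution) (i j : ℕ) :
    prod (prod U (funK B)) a (i + 1) j = B i * a i j := by
  rw [prod, tsum_eq_single i]
  · simp [prod_funK, U]
  · intro k hk
    simp [prod_funK, U, Ne.symm hk]

theorem prod_UB (B : ℕ → ℝ) (a : Distribution) (i j : ℕ) :
    prod a (prod U (funK B)) i j = a i (j + 1) * B j := by
  rw [prod, tsum_eq_single (j + 1)]
  · simp [prod_funK, U]
  · intro k hk
    simp [prod_funK, U, hk]

theorem BUstar_prod (B : ℕ → ℝ) (a : Distribution) (i j : ℕ) :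
    prod (prod (funK B) Ustar) a i j = B i * a (i + 1) j := by
  rw [prod, tsum_eq_single (i + 1)]
  · simp [funK_prod, Ustar]
  · intro k hk
    simp [funK_prod, Ustar, Ne.symm hk]

theorem prod_BUstar_zero (B : ℕ → ℝ) (a : Distribution) (i : ℕ) :
    prod a (prod (funK B) Ustar) i 0 = 0 := by
  rw [prod]
  simp [funK_prod, Ustar]

theorem prod_BUstar_succ (B : ℕ → ℝ) (a : Distribution) (i j : ℕ) :
    prod a (prod (funK B) Ustar) i (j + 1) = a i j * B j := by
  rw [prod, tsum_eq_single j]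
  · simp [funK_prod, Ustar]
  · intro k hk
    simp [funK_prod, Ustar, hk]

theorem D_zero_apply (A B : ℕ → ℝ) (a : Distribution) (j : ℕ) :
    D A B a 0 j = A 0 * (0 - a 0 (j + 1) * B j) := by
  simp [D, funK_prod, comm, UB_prod_zero, prod_UB]

theorem D_succ_apply (A B : ℕ → ℝ) (a : Distribution) (i j : ℕ) :
    D A B a (i + 1) j = A (i + 1) * (B i * a i j - a (i + 1) (j + 1) * B j) := by
  simp [D, funK_prod, comm, UB_prod_succ, prod_UB]

theorem Dbar_apply_zero (A B : ℕ → ℝ) (a : Distribution) (i : ℕ) :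
    Dbar A B a i 0 = A i * (B i * a (i + 1) 0 - 0) := by
  simp [Dbar, funK_prod, comm, BUstar_prod, prod_BUstar_zero]

theorem Dbar_apply_succ (A B : ℕ → ℝ) (a : Distribution) (i j : ℕ) :
    Dbar A B a i (j + 1) = A i * (B i * a (i + 1) (j + 1) - a i j * B j) := by
  simp [Dbar, funK_prod, comm, BUstar_prod, prod_BUstar_succ]

theorem D_add (A B : ℕ → ℝ) (a b : Distribution) : D A B (a + b) = D A B a + D A B b := by
  ext i j
  cases i <;> simp only [Matrix.add_apply, D_zero_apply, D_succ_apply] <;> ring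

theorem D_smul (A B : ℕ → ℝ) (z : ℂ) (a : Distribution) : D A B (z • a) = z • D A B a := by
  ext i j
  cases i <;> simp only [Matrix.smul_apply, smul_eq_mul, D_zero_apply, D_succ_apply] <;> ring

theorem Dbar_add (A B : ℕ → ℝ) (a b : Distribution) :
    Dbar A B (a + b) = Dbar A B a + Dbar A B b := by
  ext i j
  cases j <;> simp only [Matrix.add_apply, Dbar_apply_zero, Dbar_apply_succ] <;> ring

theorem Dbar_smul (A B : ℕ → ℝ) (z : ℂ) (a : Distribution) :
    Dbar A B (z • a) = z • Dbar A B a := by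
  ext i j
  cases j <;> simp only [Matrix.smul_apply, smul_eq_mul, Dbar_apply_zero, Dbar_apply_succ] <;> ring

/-! ### The weighted Hilbert space -/

/-- The weight sequence `A(k)` and the coefficient sequence `B(k)`. -/
structure Coefficients where
  A : ℕ → ℝ
  B : ℕ → ℝ
  A_pos : ∀ k, 0 < A k
  summable_inv_A : Summable fun k => (A k)⁻¹
  B_pos : ∀ k, 0 < B k
  monotone_B : Monotone B
  tendsto_B : Tendsto B atTop (𝓝 1)

variable (c : Coefficients)

/-- The Hilbert-Schmidt matrix `A(K)^{-1/2} a`, as a family of numbers. -/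
def Coefficients.scale (a : Distribution) (p : ℕ × ℕ) : ℂ :=
  (((Real.sqrt (c.A p.1))⁻¹ : ℝ) : ℂ) * a p.1 p.2

theorem Coefficients.norm_scale_sq (a : Distribution) (p : ℕ × ℕ) :
    ‖c.scale a p‖ ^ 2 = (c.A p.1)⁻¹ * ‖a p.1 p.2‖ ^ 2 := by
  rw [scale, norm_mul, mul_pow, Complex.norm_real, Real.norm_eq_abs, sq_abs, inv_pow,
    Real.sq_sqrt (c.A_pos _).le]

theorem Coefficients.scale_memℓp_iff (a : Distribution) :
    Memℓp (c.scale a) 2 ↔ Summable fun p : ℕ × ℕ => (c.A p.1)⁻¹ * ‖a p.1 p.2‖ ^ 2 := by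
  rw [memℓp_gen_iff (by simp)]
  simp only [← c.norm_scale_sq]
  norm_num

theorem Coefficients.scale_add (a b : Distribution) :
    c.scale (a + b) = c.scale a + c.scale b := by
  funext p
  simp only [scale, Matrix.add_apply, Pi.add_apply]
  ring

theorem Coefficients.scale_smul (z : ℂ) (a : Distribution) :
    c.scale (z • a) = z • c.scale a := by
  funext p
  simp only [scale, Matrix.smul_apply, Pi.smul_apply, smul_eq_mul]
  ring

/-- The inverse of `scale`. -/
def Coefficients.unscale (x : ℕ × ℕ → ℂ) : Distribution :=
  fun i j => ((Real.sqrt (c.A i) : ℝ) : ℂ) * x (i, j)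

theorem Coefficients.sqrt_ne_zero (i : ℕ) : ((Real.sqrt (c.A i) : ℝ) : ℂ) ≠ 0 := by
  exact_mod_cast (Real.sqrt_pos.2 (c.A_pos i)).ne'

theorem Coefficients.scale_unscale (x : ℕ × ℕ → ℂ) : c.scale (c.unscale x) = x := by
  funext p
  rw [scale, unscale, Complex.ofReal_inv, inv_mul_cancel_left₀ (c.sqrt_ne_zero _)]

theorem Coefficients.unscale_scale (a : Distribution) : c.unscale (c.scale a) = a := by
  ext i j
  rw [unscale, scale, Complex.ofReal_inv, mul_inv_cancel_left₀ (c.sqrt_ne_zero _)]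

/-- The subspace of distributions `a` of finite norm
`‖a‖_A² = Tr (A(K)⁻¹ a a*) = ∑_{i,j} A(i)⁻¹ |a_{ij}|²`. -/
def Coefficients.finiteNorm : Submodule ℂ Distribution where
  carrier := {a | Summable fun p : ℕ × ℕ => (c.A p.1)⁻¹ * ‖a p.1 p.2‖ ^ 2}
  zero_mem' := by simp
  add_mem' := by
    intro a b ha hb
    rw [Set.mem_ofPred_eq, ← c.scale_memℓp_iff] at *
    rw [c.scale_add]
    exact ha.add hb
  smul_mem' := by
    intro z a ha
    rw [Set.mem_ofPred_eq, ← c.scale_memℓp_iff] at *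
    rw [c.scale_smul]
    exact ha.const_smul z

theorem Coefficients.mem_finiteNorm (a : Distribution) : a ∈ c.finiteNorm ↔
    Summable fun p : ℕ × ℕ => (c.A p.1)⁻¹ * ‖a p.1 p.2‖ ^ 2 := Iff.rfl

/-- The weighted Hilbert space `L²_A`: the distributions of finite norm, with the inner product
defined below. -/
def Coefficients.L2 : Type := c.finiteNorm

instance : AddCommGroup c.L2 := inferInstanceAs (AddCommGroup c.finiteNorm)

instance : Module ℂ c.L2 := inferInstanceAs (Module ℂ c.finiteNorm)

/-- The distribution underlying an element of `L²_A`. -/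
def Coefficients.L2.toDist {c : Coefficients} (a : c.L2) : Distribution := a.1

/-- A distribution of finite norm, as an element of `L²_A`. -/
def Coefficients.L2.mk {c : Coefficients} (a : Distribution) (h : a ∈ c.finiteNorm) : c.L2 :=
  ⟨a, h⟩

@[simp] theorem toDist_mk {c : Coefficients} (a : Distribution) (h : a ∈ c.finiteNorm) :
    (Coefficients.L2.mk a h).toDist = a := rfl

theorem toDist_mem {c : Coefficients} (a : c.L2) : a.toDist ∈ c.finiteNorm := a.2

theorem toDist_injective {c : Coefficients} :
    Function.Injective (Coefficients.L2.toDist : c.L2 → Distribution) := Subtype.val_injective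

/-- The linear isomorphism `a ↦ A(K)^{-1/2} a` onto the square summable matrices. -/
def Coefficients.toLp : c.L2 ≃ₗ[ℂ] lp (fun _ : ℕ × ℕ => ℂ) 2 where
  toFun a := ⟨c.scale a.toDist, (c.scale_memℓp_iff _).2 (toDist_mem a)⟩
  map_add' a b := by
    refine Subtype.ext ?_
    exact c.scale_add a.toDist b.toDist
  map_smul' z a := by
    refine Subtype.ext ?_
    exact c.scale_smul z a.toDist
  invFun x := .mk (c.unscale x) ((c.scale_memℓp_iff _).1 (by
    rw [c.scale_unscale]
    exact lp.memℓp x))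
  left_inv a := toDist_injective (c.unscale_scale _)
  right_inv x := Subtype.ext (c.scale_unscale _)

/-- The inner product `(a, b)_A = Tr (A(K)⁻¹ b a*)`, antilinear in the first variable. -/
def Coefficients.innerA (a b : c.L2) : ℂ :=
  ∑' p : ℕ × ℕ, (((c.A p.1)⁻¹ : ℝ) : ℂ) * (b.toDist p.1 p.2 * conj (a.toDist p.1 p.2))

theorem Coefficients.inner_toLp (a b : c.L2) :
    inner ℂ (c.toLp a) (c.toLp b) = c.innerA a b := by
  rw [lp.inner_eq_tsum, innerA]
  refine tsum_congr fun p => ?_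
  have h : (c.A p.1)⁻¹ = (Real.sqrt (c.A p.1))⁻¹ * (Real.sqrt (c.A p.1))⁻¹ := by
    rw [← mul_inv, Real.mul_self_sqrt (c.A_pos _).le]
  rw [h]
  simp only [toLp, scale, LinearEquiv.coe_mk, LinearMap.coe_mk, AddHom.coe_mk, RCLike.inner_apply,
    map_mul, Complex.conj_ofReal, Complex.ofReal_mul]
  ring

/-- The inner product makes `L²_A` a pre-Hilbert space. -/
@[reducible] def Coefficients.core : InnerProductSpace.Core ℂ c.L2 where
  inner a b := c.innerA a b
  conj_inner_symm a b := by
    simp only [← c.inner_toLp]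
    exact inner_conj_symm _ _
  re_inner_nonneg a := by
    simp only [← c.inner_toLp]
    exact inner_self_nonneg
  add_left a b d := by
    simp only [← c.inner_toLp, map_add]
    exact inner_add_left _ _ _
  smul_left a b z := by
    simp only [← c.inner_toLp, map_smul]
    exact inner_smul_left _ _ _
  definite a h := by
    simp only [← c.inner_toLp] at h
    exact c.toLp.map_eq_zero_iff.1 (inner_self_eq_zero.1 h)

instance : NormedAddCommGroup c.L2 := c.core.toNormedAddCommGroup

instance : InnerProductSpace ℂ c.L2 := InnerProductSpace.ofCore c.core.toCore

@[simp] theorem toDist_zero : (0 : c.L2).toDist = 0 := rfl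

@[simp] theorem toDist_add (a b : c.L2) : (a + b).toDist = a.toDist + b.toDist := rfl

@[simp] theorem toDist_smul (z : ℂ) (a : c.L2) : (z • a).toDist = z • a.toDist := rfl

theorem inner_eq (a b : c.L2) : inner ℂ a b =
    ∑' p : ℕ × ℕ, (((c.A p.1)⁻¹ : ℝ) : ℂ) * (b.toDist p.1 p.2 * conj (a.toDist p.1 p.2)) := rfl

/-- `a ↦ A(K)^{-1/2} a` is unitary. -/
def Coefficients.toLpIsometry : c.L2 ≃ₗᵢ[ℂ] lp (fun _ : ℕ × ℕ => ℂ) 2 :=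
  c.toLp.isometryOfInner fun a b => (c.inner_toLp a b)

instance : CompleteSpace c.L2 :=
  (completeSpace_congr (e := c.toLpIsometry.toLinearEquiv.toEquiv)
    c.toLpIsometry.isometry.isUniformEmbedding).2 inferInstance

/-! ### The Toeplitz algebra

The Toeplitz algebra is a dense subspace of the Hilbert space `L²_A`. -/

/-- The Hilbert space `l²`. -/
abbrev l2N : Type := lp (fun _ : ℕ => ℂ) 2

/-- The canonical basis of `l²`. -/
def e (k : ℕ) : l2N := lp.single 2 k 1

theorem inner_e_left (i : ℕ) (x : l2N) : inner ℂ (e i) x = x i := by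
  rw [e, lp.inner_single_left]
  simp

theorem e_apply (i j : ℕ) : (e j : ∀ _ : ℕ, ℂ) i = if i = j then 1 else 0 := by
  rw [e, lp.single_apply]
  by_cases h : i = j
  · subst h; simp
  · simp [h]

theorem ext_e {x y : l2N} (h : ∀ i, inner ℂ (e i) x = inner ℂ (e i) y) : x = y := by
  ext i
  simpa [inner_e_left] using h i

theorem orthogonalFamily_shift : OrthogonalFamily ℂ (fun _ : ℕ => ℂ)
    fun k => LinearIsometry.toSpanSingleton ℂ l2N (v := e (k + 1)) (by
      rw [e, lp.norm_single (by norm_num)]; simp) := by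
  intro i j hij v w
  simp only [LinearIsometry.toSpanSingleton_apply, inner_smul_left, inner_smul_right, inner_e_left,
    e_apply]
  simp [hij]

/-- The unilateral shift on `l²`. -/
def shift : l2N →L[ℂ] l2N := orthogonalFamily_shift.linearIsometry.toContinuousLinearMap

theorem shift_e (k : ℕ) : shift (e k) = e (k + 1) := by
  have := orthogonalFamily_shift.linearIsometry_apply_single (i := k) (1 : ℂ)
  rw [shift, LinearIsometry.coe_toContinuousLinearMap, e, this]
  simp

/-- The Toeplitz algebra: the unital C*-algebra generated by the unilateral shift. -/
def toeplitz : StarSubalgebra ℂ (l2N →L[ℂ] l2N) := StarAlgebra.elemental ℂ shift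

/-- The matrix of an operator. -/
def matrixOf (T : l2N →L[ℂ] l2N) : Distribution := fun i j => inner ℂ (e i) (T (e j))

theorem matrixOf_shift : matrixOf shift = U := by
  ext i j
  rw [matrixOf, shift_e, inner_e_left, e_apply, U]

theorem hasSum_norm_sq (x : l2N) : HasSum (fun j => ‖x j‖ ^ 2) (‖x‖ ^ 2) := by
  have h := lp.hasSum_norm (p := 2) (by norm_num) x
  simpa only [ENNReal.toReal_ofNat, Real.rpow_ofNat] using h

theorem hasSum_row (T : l2N →L[ℂ] l2N) (i : ℕ) :
    HasSum (fun j => ‖matrixOf T i j‖ ^ 2) (‖ContinuousLinearMap.adjoint T (e i)‖ ^ 2) := by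
  have h : ∀ j, ‖matrixOf T i j‖ = ‖ContinuousLinearMap.adjoint T (e i) j‖ := by
    intro j
    rw [matrixOf, ← ContinuousLinearMap.adjoint_inner_left, ← inner_conj_symm, RCLike.norm_conj,
      inner_e_left]
  simp only [h]
  exact hasSum_norm_sq _

theorem norm_e (i : ℕ) : ‖e i‖ = 1 := by
  rw [e, lp.norm_single (by norm_num), norm_one]

theorem norm_adjoint_e_le (T : l2N →L[ℂ] l2N) (i : ℕ) :
    ‖ContinuousLinearMap.adjoint T (e i)‖ ^ 2 ≤ ‖ContinuousLinearMap.adjoint T‖ ^ 2 := by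
  have h := (ContinuousLinearMap.adjoint T).le_opNorm (e i)
  rw [norm_e, mul_one] at h
  exact pow_le_pow_left₀ (norm_nonneg _) h 2

theorem matrixOf_mem (T : l2N →L[ℂ] l2N) : matrixOf T ∈ c.finiteNorm := by
  have hA : ∀ i, 0 ≤ (c.A i)⁻¹ := fun i => inv_nonneg.2 (c.A_pos i).le
  have h : ∀ i, HasSum (fun j => (c.A i)⁻¹ * ‖matrixOf T i j‖ ^ 2)
      ((c.A i)⁻¹ * ‖ContinuousLinearMap.adjoint T (e i)‖ ^ 2) :=
    fun i => (hasSum_row T i).mul_left _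
  have h2 : Summable fun i => (c.A i)⁻¹ * ‖ContinuousLinearMap.adjoint T (e i)‖ ^ 2 :=
    Summable.of_nonneg_of_le (fun i => mul_nonneg (hA i) (sq_nonneg _))
      (fun i => mul_le_mul_of_nonneg_left (norm_adjoint_e_le T i) (hA i))
      (c.summable_inv_A.mul_right (‖ContinuousLinearMap.adjoint T‖ ^ 2))
  have h3 : ∀ p : ℕ × ℕ, 0 ≤ (c.A p.1)⁻¹ * ‖matrixOf T p.1 p.2‖ ^ 2 :=
    fun p => mul_nonneg (hA p.1) (sq_nonneg _)
  have h4 : Summable fun i => ∑' j, (c.A i)⁻¹ * ‖matrixOf T i j‖ ^ 2 := by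
    simpa only [(h _).tsum_eq] using h2
  exact (c.mem_finiteNorm _).2 ((summable_prod_of_nonneg h3).2 ⟨fun i => (h i).summable, h4⟩)

/-- The embedding of the Toeplitz algebra into `L²_A`. -/
def toeplitzEmbedding : toeplitz →ₗ[ℂ] c.L2 where
  toFun T := .mk (matrixOf T) (matrixOf_mem c T)
  map_add' S T := toDist_injective (by
    ext i j
    simp [matrixOf])
  map_smul' z T := toDist_injective (by
    ext i j
    simp [matrixOf])

theorem adjoint_shift_e_zero : ContinuousLinearMap.adjoint shift (e 0) = 0 := by
  refine ext_e fun i => ?_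
  rw [ContinuousLinearMap.adjoint_inner_right, shift_e, inner_e_left, e_apply]
  simp

theorem adjoint_shift_e_succ (k : ℕ) :
    ContinuousLinearMap.adjoint shift (e (k + 1)) = e k := by
  refine ext_e fun i => ?_
  rw [ContinuousLinearMap.adjoint_inner_right, shift_e, inner_e_left, inner_e_left, e_apply,
    e_apply]
  simp

theorem shift_pow_e (n k : ℕ) : (shift ^ n) (e k) = e (k + n) := by
  induction n with
  | zero => simp
  | succ n ih =>
    rw [pow_succ', mul_apply_eq_comp, ih, shift_e]
    rfl

theorem adjoint_shift_pow_e (n k : ℕ) :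
    (star shift ^ n) (e k) = if n ≤ k then e (k - n) else 0 := by
  induction n with
  | zero => simp
  | succ n ih =>
    rw [pow_succ', mul_apply_eq_comp, ih, ContinuousLinearMap.star_eq_adjoint]
    rcases lt_trichotomy n k with h | h | h
    · obtain ⟨m, rfl⟩ := Nat.exists_eq_add_of_lt h
      rw [if_pos h.le, if_pos (by omega), show n + m + 1 - n = m + 1 by omega,
        adjoint_shift_e_succ]
      congr 1
      omega
    · subst h
      simp [adjoint_shift_e_zero]
    · rw [if_neg (by omega), if_neg (by omega), map_zero]

theorem exists_matrixUnit (i j : ℕ) : ∃ T : toeplitz, ∀ k l,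
    matrixOf T k l = if k = i ∧ l = j then 1 else 0 := by
  have hs : shift ∈ toeplitz := StarAlgebra.elemental.self_mem ℂ shift
  have hss : star shift ∈ toeplitz := star_mem hs
  refine ⟨⟨shift ^ i * (1 - shift * star shift) * star shift ^ j, mul_mem (mul_mem (pow_mem hs i)
    (sub_mem (one_mem _) (mul_mem hs hss))) (pow_mem hss j)⟩, fun k l => ?_⟩
  simp only [matrixOf, mul_apply_eq_comp, adjoint_shift_pow_e]
  rcases lt_trichotomy l j with h | h | h
  · rw [if_neg (by omega), map_zero, map_zero, inner_zero_right, if_neg (by omega)]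
  · subst h
    rw [if_pos le_rfl, Nat.sub_self, sub_apply, one_apply_eq_self, mul_apply_eq_comp,
      ContinuousLinearMap.star_eq_adjoint, adjoint_shift_e_zero, map_zero, sub_zero, shift_pow_e,
      inner_e_left, e_apply, Nat.zero_add]
    simp
  · obtain ⟨m, rfl⟩ := Nat.exists_eq_add_of_lt h
    rw [if_pos h.le, show j + m + 1 - j = m + 1 by omega]
    have : ¬ (k = i ∧ j + m + 1 = j) := by omega
    simp [ContinuousLinearMap.star_eq_adjoint, adjoint_shift_e_succ, shift_e, this]

theorem denseRange_toeplitzEmbedding : DenseRange (toeplitzEmbedding c) := by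
  have h : (LinearMap.range (toeplitzEmbedding c)).topologicalClosure = ⊤ := by
    rw [Submodule.topologicalClosure_eq_top_iff, Submodule.eq_bot_iff]
    intro b hb
    refine toDist_injective ?_
    ext i j
    obtain ⟨T, hT⟩ := exists_matrixUnit i j
    have := (Submodule.mem_orthogonal _ _).1 hb _ ⟨T, rfl⟩
    rw [inner_eq, tsum_eq_single (i, j)] at this
    · have hA : ((c.A i : ℝ) : ℂ) ≠ 0 := by exact_mod_cast (c.A_pos i).ne'
      simpa [toeplitzEmbedding, hT, hA] using this
    · rintro ⟨k, l⟩ hkl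
      have : ¬ (k = i ∧ l = j) := by simpa using hkl
      simp [toeplitzEmbedding, hT, this]
  exact Submodule.dense_iff_topologicalClosure_eq_top.2 h

/-! ### The boundary -/

instance : Fact (0 < 2 * π) := ⟨Real.two_pi_pos⟩

/-- `L²(S¹)`, for the measure `dφ / 2π`. The function `e^{inφ}` is `fourierLp 2 n`. -/
abbrev L2Circle : Type := Lp ℂ 2 (AddCircle.haarAddCircle (T := 2 * π))

/-- `P_N`, the orthogonal projection in `L²(S¹)` onto the closed span of `e^{inφ}`, `n ≤ N`. -/
def projN (N : ℤ) : L2Circle →L[ℂ] L2Circle :=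
  (Submodule.span ℂ {φ : L2Circle | ∃ n ≤ N, φ = fourierLp 2 n}).topologicalClosure.starProjection

/-- `φ = r(a)`: the limits of the coefficient functions of `a` exist and
`φ = ∑_{n ≥ 1} f_n^b e^{-inφ} + ∑_{n ≥ 0} g_n^b e^{inφ}`. -/
def IsBoundaryValue (a : Distribution) (φ : L2Circle) : Prop :=
  (∀ n : ℕ, 1 ≤ n → Tendsto (fCoeff a n) atTop (𝓝 (fourierCoeff φ (-(n : ℤ))))) ∧
    ∀ n : ℕ, Tendsto (gCoeff a n) atTop (𝓝 (fourierCoeff φ (n : ℤ)))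

/-- The product of `e^{-iφ}` and an element of `L²(S¹)`. -/
def mulExpNeg (φ : L2Circle) : L2Circle :=
  (fourierLp ∞ (-1) : Lp ℂ ∞ (AddCircle.haarAddCircle (T := 2 * π))) • φ

theorem IsBoundaryValue.zero : IsBoundaryValue 0 0 := by
  simp only [IsBoundaryValue, ← fourierBasis_repr, map_zero]
  exact ⟨fun n _ => tendsto_const_nhds, fun n => tendsto_const_nhds⟩

theorem IsBoundaryValue.add {a b : Distribution} {φ ψ : L2Circle} (ha : IsBoundaryValue a φ)
    (hb : IsBoundaryValue b ψ) : IsBoundaryValue (a + b) (φ + ψ) := by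
  simp only [IsBoundaryValue, ← fourierBasis_repr] at *
  constructor
  · intro n hn
    rw [map_add]
    exact (ha.1 n hn).add (hb.1 n hn)
  · intro n
    rw [map_add]
    exact (ha.2 n).add (hb.2 n)

theorem IsBoundaryValue.smul {a : Distribution} {φ : L2Circle} (z : ℂ)
    (ha : IsBoundaryValue a φ) : IsBoundaryValue (z • a) (z • φ) := by
  simp only [IsBoundaryValue, ← fourierBasis_repr] at *
  constructor
  · intro n hn
    rw [map_smul]
    exact (ha.1 n hn).const_smul z
  · intro n
    rw [map_smul]
    exact (ha.2 n).const_smul z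

theorem mulExpNeg_add (φ ψ : L2Circle) : mulExpNeg (φ + ψ) = mulExpNeg φ + mulExpNeg ψ :=
  Lp.add_smul _ _ _

theorem mulExpNeg_smul (z : ℂ) (φ : L2Circle) : mulExpNeg (z • φ) = z • mulExpNeg φ :=
  (Lp.smul_comm _ _ _).symm

/-! ### The operators -/

/-- The maximal domain `{a ∈ L²_A : D a ∈ L²_A}` of `D`. -/
def domMaxD : Submodule ℂ c.L2 where
  carrier := {a | D c.A c.B a.toDist ∈ c.finiteNorm}
  zero_mem' := by
    rw [Set.mem_ofPred_eq, ← zero_smul ℂ (0 : c.L2), toDist_smul, D_smul, zero_smul]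
    exact zero_mem _
  add_mem' := by
    intro a b ha hb
    rw [Set.mem_ofPred_eq, toDist_add, D_add]
    exact add_mem ha hb
  smul_mem' := by
    intro z a ha
    rw [Set.mem_ofPred_eq, toDist_smul, D_smul]
    exact Submodule.smul_mem _ z ha

theorem mem_domMaxD (a : c.L2) : a ∈ domMaxD c ↔ D c.A c.B a.toDist ∈ c.finiteNorm := Iff.rfl

/-- The maximal domain `{a ∈ L²_A : D̄ a ∈ L²_A}` of `D̄`. -/
def domMaxDbar : Submodule ℂ c.L2 where
  carrier := {a | Dbar c.A c.B a.toDist ∈ c.finiteNorm}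
  zero_mem' := by
    rw [Set.mem_ofPred_eq, ← zero_smul ℂ (0 : c.L2), toDist_smul, Dbar_smul, zero_smul]
    exact zero_mem _
  add_mem' := by
    intro a b ha hb
    rw [Set.mem_ofPred_eq, toDist_add, Dbar_add]
    exact add_mem ha hb
  smul_mem' := by
    intro z a ha
    rw [Set.mem_ofPred_eq, toDist_smul, Dbar_smul]
    exact Submodule.smul_mem _ z ha

theorem mem_domMaxDbar (a : c.L2) : a ∈ domMaxDbar c ↔ Dbar c.A c.B a.toDist ∈ c.finiteNorm := Iff.rfl

/-- The elements `a` of `L²_A` with `r(a) ∈ Ran P_N`. -/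
def boundaryRan (N : ℤ) : Submodule ℂ c.L2 where
  carrier := {a | ∃ φ : L2Circle, IsBoundaryValue a.toDist φ ∧ φ ∈ LinearMap.range (projN N).toLinearMap}
  zero_mem' := ⟨0, by rw [toDist_zero]; exact .zero, zero_mem _⟩
  add_mem' := by
    rintro a b ⟨φ, hφ, hφ'⟩ ⟨ψ, hψ, hψ'⟩
    exact ⟨φ + ψ, by rw [toDist_add]; exact hφ.add hψ, add_mem hφ' hψ'⟩
  smul_mem' := by
    rintro z a ⟨φ, hφ, hφ'⟩
    exact ⟨z • φ, by rw [toDist_smul]; exact hφ.smul z, Submodule.smul_mem _ z hφ'⟩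

/-- The elements `a` of `L²_A` with `e^{-iφ} r(a) ∈ Ker P_N`. -/
def boundaryKer (N : ℤ) : Submodule ℂ c.L2 where
  carrier := {a | ∃ φ : L2Circle, IsBoundaryValue a.toDist φ ∧
    mulExpNeg φ ∈ LinearMap.ker (projN N).toLinearMap}
  zero_mem' := by
    refine ⟨0, by rw [toDist_zero]; exact .zero, ?_⟩
    rw [← zero_smul ℂ (0 : L2Circle), mulExpNeg_smul, zero_smul]
    exact zero_mem _
  add_mem' := by
    rintro a b ⟨φ, hφ, hφ'⟩ ⟨ψ, hψ, hψ'⟩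
    refine ⟨φ + ψ, by rw [toDist_add]; exact hφ.add hψ, ?_⟩
    rw [mulExpNeg_add]
    exact add_mem hφ' hψ'
  smul_mem' := by
    rintro z a ⟨φ, hφ, hφ'⟩
    refine ⟨z • φ, by rw [toDist_smul]; exact hφ.smul z, ?_⟩
    rw [mulExpNeg_smul]
    exact Submodule.smul_mem _ z hφ'

/-- `D_{P_N}`: the operator `D` with the domain `{a ∈ Dom_max(D) : r(a) ∈ Ran P_N}`. -/
def DPN (N : ℤ) : c.L2 →ₗ.[ℂ] c.L2 where
  domain := domMaxD c ⊓ boundaryRan c N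
  toFun :=
    { toFun := fun a => .mk (D c.A c.B (a : c.L2).toDist) ((mem_domMaxD c a).1 a.2.1)
      map_add' := fun a b => toDist_injective (by
        simp only [toDist_mk, Submodule.coe_add, toDist_add, D_add])
      map_smul' := fun z a => toDist_injective (by
        simp only [toDist_mk, Submodule.coe_smul, toDist_smul, D_smul, RingHom.id_apply]) }

/-- The operator `D̄` with the domain `{a ∈ Dom_max(D̄) : e^{-iφ} r(a) ∈ Ker P_N}`. -/
def DbarPN (N : ℤ) : c.L2 →ₗ.[ℂ] c.L2 where
  domain := domMaxDbar c ⊓ boundaryKer c N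
  toFun :=
    { toFun := fun a => .mk (Dbar c.A c.B (a : c.L2).toDist) ((mem_domMaxDbar c a).1 a.2.1)
      map_add' := fun a b => toDist_injective (by
        simp only [toDist_mk, Submodule.coe_add, toDist_add, Dbar_add])
      map_smul' := fun z a => toDist_injective (by
        simp only [toDist_mk, Submodule.coe_smul, toDist_smul, Dbar_smul, RingHom.id_apply]) }

theorem toDist_DPN (N : ℤ) (a : (DPN c N).domain) :
    (DPN c N a).toDist = D c.A c.B (a : c.L2).toDist := rfl

theorem toDist_DbarPN (N : ℤ) (a : (DbarPN c N).domain) :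
    (DbarPN c N a).toDist = Dbar c.A c.B (a : c.L2).toDist := rfl

end QuantumDisk

end

/-! Everything happens on the diagonals `row - column = k` of a matrix, which correspond to the
Fourier modes `e^{ikφ}`. Up to the factor `A`, `D` maps the diagonal `k` to the diagonal `k + 1` by
a first order difference operator `diff c k`, and `D̄` maps the diagonal `k + 1` back to `k` by its
formal transpose, which is `-diff c (-k - 1)` (`diag_D`, `diag_Dbar`). With the weights
`w_m(t) = B(t) ⋯ B(t+m-1)`, which increase to `1`, the difference equations are solved by explicit
sums (`fwd_eq`, `sum_weight_mul_bwd`), and monotonicity of `B` gives the bound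
`sup |x| ≤ B(0)⁻¹ ∑ |y|` for solutions of `diff c k x = y`: for every solution if `k < 0`, and for
the solution vanishing at infinity if `k ≥ 0`. Since `∑ A(k)⁻¹ < ∞`, the Cauchy–Schwarz inequality
turns this into bounds in `L²_A` that are uniform in `k`. Hence boundary values exist on the maximal
domains, and the boundary conditions only say that certain limits vanish (`mem_boundaryRan_iff`,
`mem_boundaryKer_iff`).

Summation by parts on each diagonal gives Green's formula
`(a, D̄ b) - (D a, b) = ∑ conj (r(a)_k) r(b)_{k+1}` (`hasSum_boundary`). With the test elements whose
boundary value is a single mode it shows that the boundary conditions for `D` and `D̄` are dual to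
each other, whence the adjoint (`adjoint_DPN`), and that they are closed in the graph norm
(`isClosed_DPN`).

The kernel of `D` is spanned by one element on each diagonal `k ≥ 0`, the weight `w_k`, with the
boundary value `e^{ikφ}`, so that the kernel of `D_{P_N}` has the coordinates `0 ≤ k ≤ N`. Every
`b` is of the form `D a` with `r(a)` supported in `k < 0` (`exists_applyD_eq`), and the limit of `a`
on the diagonal `-m - 1` is minus the pairing of `b` with an element `kerDbar c m` of the kernel of
`D̄` (`tendsto_diag_neg`). So the range of `D_{P_N}` is cut out by the vanishing of these pairings
for `-m - 1 > N`, that is, by `max (-N - 1) 0` independent continuous functionals. -/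

noncomputable section

namespace QuantumDisk

/-! ### Boundary values on the circle -/

theorem mem_orthogonal_span {H : Type*} [NormedAddCommGroup H] [InnerProductSpace ℂ H]
    (s : Set H) (x : H) : x ∈ (Submodule.span ℂ s)ᗮ ↔ ∀ u ∈ s, inner ℂ u x = 0 := by
  rw [Submodule.mem_orthogonal]
  refine ⟨fun h u hu => h u (Submodule.subset_span hu), fun h u hu => ?_⟩
  induction hu using Submodule.span_induction with
  | mem u hu => exact h u hu
  | zero => exact inner_zero_left _
  | add u v _ _ hu hv => rw [inner_add_left, hu, hv, add_zero]
  | smul z u _ hu => rw [inner_smul_left, hu, mul_zero]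

theorem fourierCoeff_eq_inner (φ : L2Circle) (n : ℤ) :
    fourierCoeff φ n = inner ℂ (fourierLp 2 n : L2Circle) φ := by
  rw [← fourierBasis_repr, HilbertBasis.repr_apply_apply, coe_fourierBasis]

theorem fourierCoeff_fourierLp (m n : ℤ) :
    fourierCoeff (fourierLp 2 m : L2Circle) n = if n = m then 1 else 0 := by
  rw [fourierCoeff_eq_inner]
  exact orthonormal_iff_ite.1 orthonormal_fourier n m

theorem mem_range_projN (N : ℤ) (φ : L2Circle) :
    φ ∈ LinearMap.range (projN N).toLinearMap ↔ ∀ n, N < n → fourierCoeff φ n = 0 := by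
  rw [projN, Submodule.range_starProjection]
  constructor
  · intro h n hn
    rw [fourierCoeff_eq_inner]
    have : (fourierLp 2 n : L2Circle) ∈
        (Submodule.span ℂ {φ : L2Circle | ∃ n ≤ N, φ = fourierLp 2 n})ᗮ := by
      rw [mem_orthogonal_span]
      rintro _ ⟨m, hm, rfl⟩
      rw [← fourierCoeff_eq_inner, fourierCoeff_fourierLp, if_neg (by omega)]
    rw [← Submodule.orthogonal_closure] at this
    exact Submodule.inner_left_of_mem_orthogonal h this
  · intro h
    refine (Submodule.isClosed_topologicalClosure _).mem_of_tendsto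
      (hasSum_fourier_series_L2 φ) (Eventually.of_forall fun s => ?_)
    refine Submodule.sum_mem _ fun n _ => ?_
    by_cases hn : n ≤ N
    · exact Submodule.smul_mem _ _
        (Submodule.le_topologicalClosure _ (Submodule.subset_span ⟨n, hn, rfl⟩))
    · rw [h n (by omega), zero_smul]
      exact zero_mem _

theorem mem_ker_projN (N : ℤ) (φ : L2Circle) :
    φ ∈ LinearMap.ker (projN N).toLinearMap ↔ ∀ n, n ≤ N → fourierCoeff φ n = 0 := by
  rw [projN, Submodule.ker_starProjection, Submodule.orthogonal_closure,
    mem_orthogonal_span]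
  constructor
  · intro h n hn
    rw [fourierCoeff_eq_inner]
    exact h _ ⟨n, hn, rfl⟩
  · rintro h _ ⟨n, hn, rfl⟩
    rw [← fourierCoeff_eq_inner]
    exact h n hn

theorem fourierCoeff_mulExpNeg (φ : L2Circle) (n : ℤ) :
    fourierCoeff (mulExpNeg φ) n = fourierCoeff φ (n + 1) := by
  rw [fourierCoeff, fourierCoeff]
  refine integral_congr_ae ?_
  filter_upwards [Lp.coeFn_lpSMul (r := 2)
    (fourierLp ∞ (-1) : Lp ℂ ∞ (AddCircle.haarAddCircle (T := 2 * π))) φ,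
    coeFn_fourierLp (T := 2 * π) ∞ (-1)] with x hx hx'
  rw [mulExpNeg, hx, Pi.smul_apply', hx', smul_smul, ← fourier_add, neg_add]

/-- By the Riesz–Fischer theorem, a square summable family is the family of Fourier
coefficients of a function in `L²(S¹)`. -/
theorem exists_fourierCoeff_eq {l : ℤ → ℂ} (hl : Summable fun n => ‖l n‖ ^ 2) :
    ∃ φ : L2Circle, ∀ n, fourierCoeff φ n = l n := by
  have hm : Memℓp l 2 := by
    rw [memℓp_gen_iff (by simp)]
    simpa using hl
  refine ⟨fourierBasis.repr.symm ⟨l, hm⟩, fun n => ?_⟩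
  rw [← fourierBasis_repr, LinearIsometryEquiv.apply_symm_apply]

/-! ### The difference equations on a diagonal -/

section Weight

variable (c : Coefficients)

theorem B_le_one (k : ℕ) : c.B k ≤ 1 := c.monotone_B.ge_of_tendsto c.tendsto_B k

/-- The weight `B(t) B(t+1) ⋯ B(t+m-1)`. It is increasing in `t`, has the limit `1`, and spans the
kernel of `fwd c m`. -/
def weight (m t : ℕ) : ℝ := ∏ k ∈ Finset.range m, c.B (t + k)

theorem weight_succ (m t : ℕ) : weight c (m + 1) t = weight c m t * c.B (t + m) :=
  Finset.prod_range_succ _ _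

theorem weight_succ' (m t : ℕ) : weight c (m + 1) t = weight c m (t + 1) * c.B t := by
  rw [weight, Finset.prod_range_succ', weight]
  simp only [add_zero, add_assoc, add_comm 1]

theorem weight_pos (m t : ℕ) : 0 < weight c m t := Finset.prod_pos fun _ _ => c.B_pos _

theorem weight_ne_zero (m t : ℕ) : ((weight c m t : ℝ) : ℂ) ≠ 0 := by
  exact_mod_cast (weight_pos c m t).ne'

theorem B_ne_zero (t : ℕ) : ((c.B t : ℝ) : ℂ) ≠ 0 := by
  exact_mod_cast (c.B_pos t).ne'

theorem weight_le_one (m t : ℕ) : weight c m t ≤ 1 :=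
  Finset.prod_le_one (fun _ _ => (c.B_pos _).le) fun _ _ => B_le_one c _

theorem weight_monotone (m : ℕ) : Monotone (weight c m) := fun s t h =>
  Finset.prod_le_prod (fun _ _ => (c.B_pos _).le) fun k _ => c.monotone_B (by omega)

theorem tendsto_weight (m : ℕ) : Tendsto (weight c m) atTop (𝓝 1) := by
  have h : Tendsto (fun t => ∏ k ∈ Finset.range m, c.B (t + k)) atTop
      (𝓝 (∏ _k ∈ Finset.range m, (1 : ℝ))) :=
    tendsto_finsetProd _ fun k _ => c.tendsto_B.comp (tendsto_add_atTop_nat k)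
  rwa [Finset.prod_const_one] at h

theorem tendsto_weight_ofReal (m : ℕ) :
    Tendsto (fun t => ((weight c m t : ℝ) : ℂ)) atTop (𝓝 1) := by
  exact_mod_cast (Complex.continuous_ofReal.tendsto 1).comp (tendsto_weight c m)

/-- In both solution formulas the coefficients are quotients of this form, with `s ≤ t + 1`; the
bound does not depend on `m`. -/
theorem weight_div_weight_succ_le {m s t : ℕ} (h : s ≤ t + 1) :
    weight c m s / weight c (m + 1) t ≤ (c.B 0)⁻¹ := by
  rw [div_le_iff₀ (weight_pos c _ _), weight_succ']
  have h1 : weight c m s ≤ weight c m (t + 1) := weight_monotone c m h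
  have h2 : 1 ≤ (c.B 0)⁻¹ * c.B t := by
    rw [inv_mul_eq_div, one_le_div (c.B_pos 0)]
    exact c.monotone_B (Nat.zero_le t)
  calc weight c m s ≤ weight c m (t + 1) * 1 := by rw [mul_one]; exact h1
    _ ≤ weight c m (t + 1) * ((c.B 0)⁻¹ * c.B t) :=
        mul_le_mul_of_nonneg_left h2 (weight_pos c _ _).le
    _ = _ := by ring

theorem norm_weight (m t : ℕ) : ‖((weight c m t : ℝ) : ℂ)‖ = weight c m t := by
  rw [Complex.norm_real, Real.norm_of_nonneg (weight_pos c m t).le]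

/-- The difference operator by which `D` acts on the coefficients `g_m`. -/
def fwd (m : ℕ) (x : ℕ → ℂ) (t : ℕ) : ℂ := c.B (t + m) * x t - c.B t * x (t + 1)

/-- The difference operator by which, up to the sign, `D` acts on the coefficients `f_{m+1}`. It is
the formal transpose of `fwd c m`. -/
def bwd (m : ℕ) (x : ℕ → ℂ) : ℕ → ℂ
  | 0 => c.B m * x 0
  | t + 1 => c.B (t + 1 + m) * x (t + 1) - c.B t * x t

variable {c}

/-- After division by the weight, `fwd c m` is a plain difference. -/
theorem fwd_eq (m : ℕ) (x : ℕ → ℂ) (t : ℕ) : fwd c m x t =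
    weight c (m + 1) t * (x t / weight c m t - x (t + 1) / weight c m (t + 1)) := by
  have h1 := weight_ne_zero c m t
  have h2 := weight_ne_zero c m (t + 1)
  rw [mul_sub]
  nth_rw 1 [weight_succ]
  rw [weight_succ', fwd]
  push_cast
  field_simp

/-- After multiplication by the weight, `bwd c m` telescopes. There is no free initial value, so
this determines `x`. -/
theorem sum_weight_mul_bwd (m : ℕ) (x : ℕ → ℂ) (T : ℕ) :
    ∑ t ∈ Finset.range (T + 1), weight c m t * bwd c m x t = weight c (m + 1) T * x T := by
  induction T with
  | zero => simp [weight_succ, bwd]; ring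
  | succ T ih =>
    rw [Finset.sum_range_succ, ih, bwd, weight_succ', weight_succ c m (T + 1)]
    push_cast
    ring

theorem fwd_weight (m : ℕ) : fwd c m (fun t => (weight c m t : ℂ)) = 0 := by
  funext t
  rw [fwd_eq, div_self (weight_ne_zero c m t), div_self (weight_ne_zero c m (t + 1))]
  simp

theorem fwd_const_mul (m : ℕ) (z : ℂ) (x : ℕ → ℂ) (t : ℕ) :
    fwd c m (fun t => z * x t) t = z * fwd c m x t := by
  simp only [fwd]
  ring

/-- The kernel of `fwd c m` is spanned by the weight. -/
theorem eq_of_fwd_eq_zero {m : ℕ} {x : ℕ → ℂ} (h : ∀ t, fwd c m x t = 0) (t : ℕ) :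
    x t = x 0 / weight c m 0 * weight c m t := by
  have h1 : ∀ t, x t / weight c m t = x 0 / weight c m 0 := by
    intro t
    induction t with
    | zero => rfl
    | succ t ih =>
      have := h t
      rw [fwd_eq, mul_eq_zero, or_iff_right (weight_ne_zero c _ _), sub_eq_zero] at this
      rw [← this, ih]
  rw [← h1 t, div_mul_cancel₀ _ (weight_ne_zero c m t)]

theorem summable_div_weight {m : ℕ} {y : ℕ → ℂ} (hy : Summable fun t => ‖y t‖) :
    Summable fun t => y t / weight c m t := by
  refine Summable.of_norm_bounded (hy.mul_right (weight c m 0)⁻¹) fun t => ?_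
  rw [norm_div, norm_weight, div_eq_mul_inv]
  exact mul_le_mul_of_nonneg_left
    (inv_anti₀ (weight_pos c m 0) (weight_monotone c m (Nat.zero_le t))) (norm_nonneg _)

theorem exists_tendsto_of_fwd {m : ℕ} {x : ℕ → ℂ} (h : Summable fun t => ‖fwd c m x t‖) :
    ∃ l, Tendsto x atTop (𝓝 l) := by
  have h1 := (summable_div_weight (c := c) (m := m + 1) h).hasSum.tendsto_sum_nat
  have h2 : ∀ T, ∑ t ∈ Finset.range T, fwd c m x t / weight c (m + 1) t =
      x 0 / weight c m 0 - x T / weight c m T := by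
    intro T
    rw [← Finset.sum_range_sub' (fun t => x t / (weight c m t : ℂ))]
    refine Finset.sum_congr rfl fun t _ => ?_
    rw [fwd_eq, mul_div_cancel_left₀ _ (weight_ne_zero c _ _)]
  simp only [h2] at h1
  refine ⟨_, ((tendsto_const_nhds (x := x 0 / (weight c m 0 : ℂ))).sub h1 |>.mul
    (tendsto_weight_ofReal c m)).congr fun T => ?_⟩
  rw [sub_sub_cancel, div_mul_cancel₀ _ (weight_ne_zero c m T)]

/-- For a summable right hand side, the equation `fwd c m x = y` has a solution that vanishes at
infinity. -/
theorem exists_fwd_eq (m : ℕ) {y : ℕ → ℂ} (hy : Summable fun t => ‖y t‖) :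
    ∃ x : ℕ → ℂ, (∀ t, fwd c m x t = y t) ∧ (∀ t, ‖x t‖ ≤ (c.B 0)⁻¹ * ∑' t, ‖y t‖) ∧
      Tendsto x atTop (𝓝 0) := by
  set u : ℕ → ℂ := fun t => y t / weight c (m + 1) t with hu
  have hsum : Summable u := summable_div_weight hy
  have htail : ∀ t, ∑' l, u (l + t) = u t + ∑' l, u (l + (t + 1)) := by
    intro t
    rw [((summable_nat_add_iff t).2 hsum).tsum_eq_zero_add, zero_add]
    simp only [add_assoc, add_comm 1]
  refine ⟨fun t => weight c m t * ∑' l, u (l + t), fun t => ?_, fun t => ?_, ?_⟩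
  · rw [fwd_eq, mul_div_cancel_left₀ _ (weight_ne_zero c _ _),
      mul_div_cancel_left₀ _ (weight_ne_zero c _ _), htail, add_sub_cancel_right, hu]
    exact mul_div_cancel₀ _ (weight_ne_zero c _ _)
  · have hys : Summable fun l => ‖y (l + t)‖ := (summable_nat_add_iff t).2 hy
    calc ‖(weight c m t : ℂ) * ∑' l, u (l + t)‖ = ‖∑' l, (weight c m t : ℂ) * u (l + t)‖ := by
          rw [tsum_mul_left]
      _ ≤ ∑' l, (c.B 0)⁻¹ * ‖y (l + t)‖ := by
          refine tsum_of_norm_bounded (hys.mul_left _).hasSum fun l => ?_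
          rw [hu, norm_mul, norm_div, norm_weight, norm_weight, mul_div_left_comm, mul_comm]
          exact mul_le_mul_of_nonneg_right (weight_div_weight_succ_le c (by omega))
            (norm_nonneg _)
      _ = (c.B 0)⁻¹ * ∑' l, ‖y (l + t)‖ := tsum_mul_left
      _ ≤ _ := by
          refine mul_le_mul_of_nonneg_left ?_ (inv_nonneg.2 (c.B_pos 0).le)
          rw [← hy.sum_add_tsum_nat_add t]
          exact le_add_of_nonneg_left (Finset.sum_nonneg fun _ _ => norm_nonneg _)
  · simpa using (tendsto_weight_ofReal c m).mul (tendsto_sum_nat_add u)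

theorem exists_bwd_eq (m : ℕ) (y : ℕ → ℂ) : ∃ x : ℕ → ℂ, ∀ t, bwd c m x t = y t := by
  refine ⟨fun T => (weight c (m + 1) T : ℂ)⁻¹ *
    ∑ t ∈ Finset.range (T + 1), weight c m t * y t, fun t => ?_⟩
  have h1 := weight_ne_zero c m
  have h2 := B_ne_zero c
  cases t with
  | zero =>
    have := h1 0
    have := h2 m
    simp only [bwd, zero_add, Finset.sum_range_one, weight_succ, Complex.ofReal_mul]
    field_simp
  | succ t =>
    have h3 := h1 (t + 1)
    have h4 := h2 (t + 1 + m)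
    have h5 := h2 t
    rw [bwd, Finset.sum_range_succ, weight_succ c m (t + 1), weight_succ']
    push_cast
    field_simp
    ring

theorem norm_le_of_bwd {m : ℕ} {x : ℕ → ℂ} (h : Summable fun t => ‖bwd c m x t‖) (T : ℕ) :
    ‖x T‖ ≤ (c.B 0)⁻¹ * ∑' t, ‖bwd c m x t‖ := by
  have hx : x T = ∑ t ∈ Finset.range (T + 1),
      (weight c m t / weight c (m + 1) T : ℂ) * bwd c m x t := by
    rw [eq_comm, ← mul_right_inj' (weight_ne_zero c (m + 1) T), ← sum_weight_mul_bwd,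
      Finset.mul_sum]
    refine Finset.sum_congr rfl fun t _ => ?_
    rw [← mul_assoc, mul_div_cancel₀ _ (weight_ne_zero c _ _)]
  rw [hx]
  calc _ ≤ ∑ t ∈ Finset.range (T + 1), (c.B 0)⁻¹ * ‖bwd c m x t‖ := by
        refine norm_sum_le_of_le _ fun t ht => ?_
        rw [norm_mul, norm_div, norm_weight, norm_weight]
        exact mul_le_mul_of_nonneg_right
          (weight_div_weight_succ_le c (Finset.mem_range.1 ht).le) (norm_nonneg _)
    _ ≤ _ := by
        rw [← Finset.mul_sum]
        exact mul_le_mul_of_nonneg_left (h.sum_le_tsum _ fun _ _ => norm_nonneg _)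
          (inv_nonneg.2 (c.B_pos 0).le)

theorem summable_weight_mul (m : ℕ) {y : ℕ → ℂ} (hy : Summable fun t => ‖y t‖) :
    Summable fun t => weight c m t * y t := by
  refine Summable.of_norm_bounded hy fun t => ?_
  rw [norm_mul, norm_weight]
  exact mul_le_of_le_one_left (norm_nonneg _) (weight_le_one c m t)

theorem tendsto_of_bwd {m : ℕ} {x : ℕ → ℂ} (h : Summable fun t => ‖bwd c m x t‖) :
    Tendsto x atTop (𝓝 (∑' t, weight c m t * bwd c m x t)) := by
  have h1 := ((summable_weight_mul (c := c) m h).hasSum.tendsto_sum_nat.comp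
    (tendsto_add_atTop_nat 1)).div (tendsto_weight_ofReal c (m + 1)) one_ne_zero
  rw [div_one] at h1
  refine h1.congr fun T => ?_
  simp only [Function.comp_apply, Pi.div_apply]
  rw [sum_weight_mul_bwd, mul_div_cancel_left₀ _ (weight_ne_zero c _ _)]

/-- Summation by parts: the pairing of the two difference operators leaves only the boundary
term. -/
theorem tsum_fwd_mul_sub {m : ℕ} {x z : ℕ → ℂ} {l k : ℂ}
    (h1 : Summable fun t => fwd c m x t * z t) (h2 : Summable fun t => x t * bwd c m z t)
    (hx : Tendsto x atTop (𝓝 l)) (hz : Tendsto z atTop (𝓝 k)) :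
    ∑' t, fwd c m x t * z t - ∑' t, x t * bwd c m z t = -(l * k) := by
  have h3 : ∀ T, ∑ t ∈ Finset.range (T + 1), (fwd c m x t * z t - x t * bwd c m z t) =
      -(c.B T * x (T + 1) * z T) := by
    intro T
    induction T with
    | zero => simp [fwd, bwd]; ring
    | succ T ih =>
      rw [Finset.sum_range_succ, ih, fwd, bwd]
      ring
  have h4 := ((h1.sub h2).hasSum.tendsto_sum_nat.comp (tendsto_add_atTop_nat 1))
  have hB : Tendsto (fun t => (c.B t : ℂ)) atTop (𝓝 1) := by
    exact_mod_cast (Complex.continuous_ofReal.tendsto 1).comp c.tendsto_B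
  have h5 := ((hB.mul (hx.comp (tendsto_add_atTop_nat 1))).mul hz).neg
  rw [← h1.tsum_sub h2, ← one_mul l]
  exact tendsto_nhds_unique (h4.congr h3) h5

/-- The difference operator by which `D` maps the diagonal `k` to the diagonal `k + 1`, where the
diagonal of the entry `(i, j)` is `i - j`. Up to the sign, `D̄` maps the diagonal `k + 1` to the
diagonal `k` by the operator with the index `-k - 1`. -/
def diff (c : Coefficients) : ℤ → (ℕ → ℂ) → ℕ → ℂ
  | Int.ofNat m, x, t => fwd c m x t
  | Int.negSucc m, x, t => -bwd c m x t

theorem neg_ofNat_sub_one (m : ℕ) : -Int.ofNat m - 1 = Int.negSucc m := by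
  rw [Int.negSucc_eq]
  simp only [Int.ofNat_eq_natCast]
  ring

theorem neg_negSucc_sub_one (m : ℕ) : -Int.negSucc m - 1 = Int.ofNat m := by
  rw [Int.negSucc_eq]
  simp

theorem summable_bwd {m : ℕ} {x : ℕ → ℂ}
    (h : Summable fun t => ‖diff c (Int.negSucc m) x t‖) : Summable fun t => ‖bwd c m x t‖ := by
  simpa only [diff, norm_neg] using h

theorem exists_tendsto_of_diff {k : ℤ} {x : ℕ → ℂ} (h : Summable fun t => ‖diff c k x t‖) :
    ∃ l, Tendsto x atTop (𝓝 l) := by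
  cases k with
  | ofNat m => exact exists_tendsto_of_fwd h
  | negSucc m => exact ⟨_, tendsto_of_bwd (summable_bwd h)⟩

theorem norm_le_of_diff {k : ℤ} (hk : k < 0) {x : ℕ → ℂ} (h : Summable fun t => ‖diff c k x t‖)
    (t : ℕ) : ‖x t‖ ≤ (c.B 0)⁻¹ * ∑' t, ‖diff c k x t‖ := by
  cases k with
  | ofNat m => exact absurd hk (by simp)
  | negSucc m =>
    simpa only [diff, norm_neg] using norm_le_of_bwd (summable_bwd h) t

theorem exists_diff_eq (k : ℤ) {y : ℕ → ℂ} (hy : Summable fun t => ‖y t‖) :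
    ∃ x : ℕ → ℂ, (∀ t, diff c k x t = y t) ∧ (∀ t, ‖x t‖ ≤ (c.B 0)⁻¹ * ∑' t, ‖y t‖) ∧
      (0 ≤ k → Tendsto x atTop (𝓝 0)) := by
  cases k with
  | ofNat m =>
    obtain ⟨x, h1, h2, h3⟩ := exists_fwd_eq (c := c) m hy
    exact ⟨x, h1, h2, fun _ => h3⟩
  | negSucc m =>
    obtain ⟨x, hx⟩ := exists_bwd_eq (c := c) m fun t => -y t
    have h : ∀ t, diff c (Int.negSucc m) x t = y t := fun t => by rw [diff, hx, neg_neg]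
    refine ⟨x, h, fun t => ?_, fun h => absurd h (by simp)⟩
    have := norm_le_of_diff (c := c) (Int.negSucc_lt_zero m) (x := x) (by simpa only [h] using hy) t
    simpa only [h] using this

theorem tsum_diff_mul_add {k : ℤ} {x z : ℕ → ℂ} {l l' : ℂ}
    (h1 : Summable fun t => diff c k x t * z t)
    (h2 : Summable fun t => x t * diff c (-k - 1) z t)
    (hx : Tendsto x atTop (𝓝 l)) (hz : Tendsto z atTop (𝓝 l')) :
    ∑' t, diff c k x t * z t + ∑' t, x t * diff c (-k - 1) z t = -(l * l') := by
  cases k with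
  | ofNat m =>
    rw [neg_ofNat_sub_one] at *
    simp only [diff, mul_neg] at *
    rw [tsum_neg, ← sub_eq_add_neg]
    exact tsum_fwd_mul_sub h1 h2.of_neg hx hz
  | negSucc m =>
    rw [neg_negSucc_sub_one] at *
    simp only [diff, neg_mul] at *
    have := tsum_fwd_mul_sub (c := c) (m := m) (x := z) (z := x) (by simpa only [mul_comm] using h2)
      (by simpa only [mul_comm] using h1.of_neg) hz hx
    rw [tsum_neg, mul_comm l, ← this]
    simp only [mul_comm]
    ring

theorem conj_diff (k : ℤ) (x : ℕ → ℂ) (t : ℕ) :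
    conj (diff c k x t) = diff c k (fun t => conj (x t)) t := by
  cases k with
  | ofNat m => simp [diff, fwd]
  | negSucc m => cases t <;> simp [diff, bwd]

/-- On each diagonal there is a bounded sequence with the limit `1` on which the difference
operator gives a sequence of finite support. -/
theorem exists_diff_finite (c : Coefficients) (k : ℤ) : ∃ (x : ℕ → ℂ) (C : ℝ), (∀ t, ‖x t‖ ≤ C) ∧
    (∀ t, t ≠ 0 → diff c k x t = 0) ∧ Tendsto x atTop (𝓝 1) := by
  cases k with
  | ofNat m =>
    refine ⟨_, 1, fun t => ?_, fun t _ => congr_fun (fwd_weight m) t, tendsto_weight_ofReal c m⟩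
    rw [norm_weight]
    exact weight_le_one c m t
  | negSucc m =>
    obtain ⟨x, hx⟩ := exists_bwd_eq (c := c) m (Pi.single 0 (weight c m 0 : ℂ)⁻¹)
    have h0 : ∀ t, t ≠ 0 → bwd c m x t = 0 := fun t ht => by rw [hx, Pi.single_eq_of_ne ht]
    have hs : Summable fun t => ‖bwd c m x t‖ :=
      summable_of_ne_finset_zero (s := {0}) fun t ht => by rw [h0 t (by simpa using ht), norm_zero]
    refine ⟨x, _, norm_le_of_bwd hs, fun t ht => by rw [diff, h0 t ht, neg_zero], ?_⟩
    have h := tendsto_of_bwd hs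
    rwa [tsum_eq_single 0 fun t ht => by rw [h0 t ht, mul_zero], hx, Pi.single_eq_same,
      mul_inv_cancel₀ (weight_ne_zero c m 0)] at h

end Weight

/-! ### Diagonals -/

/-- The coefficient sequence of a distribution on the diagonal `row - column = k`: it is `g_k` for
`k ≥ 0` and `f_{-k}` for `k < 0`. -/
def diag (a : Distribution) (k : ℤ) (t : ℕ) : ℂ := a (t + k.toNat) (t + (-k).toNat)

/-- The diagonals exhaust the entries of a matrix. -/
def diagEquiv : ℤ × ℕ ≃ ℕ × ℕ where
  toFun p := (p.2 + p.1.toNat, p.2 + (-p.1).toNat)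
  invFun q := ((q.1 : ℤ) - q.2, min q.1 q.2)
  left_inv p := by ext <;> simp only <;> omega
  right_inv q := by ext <;> simp only <;> omega

/-- The distribution with given diagonals. -/
def ofDiag (x : ℤ → ℕ → ℂ) : Distribution := fun i j => x ((i : ℤ) - j) (min i j)

theorem diag_ofDiag (x : ℤ → ℕ → ℂ) (k : ℤ) (t : ℕ) : diag (ofDiag x) k t = x k t := by
  have := diagEquiv.left_inv (k, t)
  simp only [diagEquiv, Prod.mk.injEq] at this
  simp only [diag, ofDiag]
  rw [this.1, this.2]

theorem ext_diag {a b : Distribution} (h : ∀ k t, diag a k t = diag b k t) : a = b := by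
  ext i j
  have := diagEquiv.right_inv (i, j)
  simp only [diagEquiv, Prod.mk.injEq] at this
  have h1 := h ((i : ℤ) - j) (min i j)
  simpa only [diag, this.1, this.2] using h1

theorem diag_ofNat (a : Distribution) (n t : ℕ) : diag a (n : ℤ) t = gCoeff a n t := by
  simp [diag, gCoeff]

theorem diag_negSucc (a : Distribution) (n t : ℕ) :
    diag a (Int.negSucc n) t = fCoeff a (n + 1) t := by
  simp [diag, fCoeff]

theorem diag_D (c : Coefficients) (a : Distribution) (k : ℤ) (t : ℕ) :
    diag (D c.A c.B a) (k + 1) t = c.A (t + (k + 1).toNat) * diff c k (diag a k) t := by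
  cases k with
  | ofNat m =>
    have h1 : (Int.ofNat m + 1).toNat = m + 1 := by simp
    have h2 : (-(Int.ofNat m + 1)).toNat = 0 := by simp
    have h3 : (Int.ofNat m).toNat = m := rfl
    have h4 : (-Int.ofNat m).toNat = 0 := by simp
    simp only [diag, diff, fwd, h1, h2, h3, h4, add_zero, ← add_assoc, D_succ_apply]
    rw [add_right_comm t 1 m]
    ring
  | negSucc m =>
    have h1 : (Int.negSucc m + 1).toNat = 0 := by simp
    have h2 : (-(Int.negSucc m + 1)).toNat = m := by rw [Int.negSucc_eq]; simp
    have h3 : (Int.negSucc m).toNat = 0 := rfl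
    have h4 : (-Int.negSucc m).toNat = m + 1 := rfl
    cases t with
    | zero =>
      simp only [diag, diff, bwd, h1, h2, h3, h4, add_zero, zero_add, D_zero_apply]
      ring
    | succ t =>
      simp only [diag, diff, bwd, h1, h2, h3, h4, add_zero, D_succ_apply]
      rw [← add_assoc (t + 1), ← add_assoc t m 1, add_right_comm t 1 m]
      ring

theorem diag_Dbar (c : Coefficients) (a : Distribution) (k : ℤ) (t : ℕ) :
    diag (Dbar c.A c.B a) k t =
      -(c.A (t + k.toNat) * diff c (-k - 1) (diag a (k + 1)) t) := by
  cases k with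
  | ofNat m =>
    rw [neg_ofNat_sub_one]
    have h1 : (Int.ofNat m + 1).toNat = m + 1 := by simp
    have h2 : (-(Int.ofNat m + 1)).toNat = 0 := by simp
    have h3 : (Int.ofNat m).toNat = m := rfl
    have h4 : (-Int.ofNat m).toNat = 0 := by simp
    cases t with
    | zero =>
      simp only [diag, diff, bwd, h1, h2, h3, h4, add_zero, zero_add, Dbar_apply_zero]
      ring
    | succ t =>
      simp only [diag, diff, bwd, h1, h2, h3, h4, add_zero, Dbar_apply_succ]
      rw [← add_assoc (t + 1), ← add_assoc t m 1, add_right_comm t 1 m]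
      ring
  | negSucc m =>
    rw [neg_negSucc_sub_one]
    have h1 : (Int.negSucc m + 1).toNat = 0 := by simp
    have h2 : (-(Int.negSucc m + 1)).toNat = m := by rw [Int.negSucc_eq]; simp
    have h3 : (Int.negSucc m).toNat = 0 := rfl
    have h4 : (-Int.negSucc m).toNat = m + 1 := rfl
    simp only [diag, diff, fwd, h1, h2, h3, h4, add_zero, ← add_assoc, Dbar_apply_succ]
    rw [add_right_comm t 1 m]
    ring

theorem isBoundaryValue_iff (a : Distribution) (φ : L2Circle) :
    IsBoundaryValue a φ ↔ ∀ k : ℤ, Tendsto (diag a k) atTop (𝓝 (fourierCoeff φ k)) := by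
  have hg : ∀ n : ℕ, diag a (n : ℤ) = gCoeff a n := fun n => funext (diag_ofNat a n)
  have hf : ∀ n : ℕ, diag a (Int.negSucc n) = fCoeff a (n + 1) := fun n =>
    funext (diag_negSucc a n)
  constructor
  · rintro ⟨h1, h2⟩ (n | n)
    · rw [Int.ofNat_eq_natCast, hg]
      exact h2 n
    · rw [hf, Int.negSucc_eq]
      exact_mod_cast h1 (n + 1) (by omega)
  · intro h
    refine ⟨fun n hn => ?_, fun n => ?_⟩
    · obtain ⟨m, rfl⟩ := Nat.exists_eq_add_of_le' hn
      have := h (Int.negSucc m)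
      rw [hf, Int.negSucc_eq] at this
      exact_mod_cast this
    · rw [← hg]
      exact h n

/-! ### The norm on the diagonals -/

variable {c : Coefficients}

theorem inv_A_nonneg (k : ℕ) : 0 ≤ (c.A k)⁻¹ := inv_nonneg.2 (c.A_pos k).le

theorem A_ne_zero (k : ℕ) : ((c.A k : ℝ) : ℂ) ≠ 0 := by
  exact_mod_cast (c.A_pos k).ne'

theorem mem_finiteNorm_iff_diag (a : Distribution) : a ∈ c.finiteNorm ↔
    Summable fun p : ℤ × ℕ => (c.A (p.2 + p.1.toNat))⁻¹ * ‖diag a p.1 p.2‖ ^ 2 := by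
  rw [c.mem_finiteNorm, ← diagEquiv.summable_iff]
  rfl

theorem summable_inner (a b : c.L2) : Summable fun p : ℕ × ℕ =>
    (((c.A p.1)⁻¹ : ℝ) : ℂ) * (b.toDist p.1 p.2 * conj (a.toDist p.1 p.2)) := by
  have ha := (c.mem_finiteNorm _).1 (toDist_mem a)
  have hb := (c.mem_finiteNorm _).1 (toDist_mem b)
  refine Summable.of_norm_bounded (ha.add hb) fun p => ?_
  rw [norm_mul, Complex.norm_real, Real.norm_of_nonneg (inv_A_nonneg _), norm_mul,
    RCLike.norm_conj, ← mul_add]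
  refine mul_le_mul_of_nonneg_left ?_ (inv_A_nonneg _)
  nlinarith [sq_nonneg (‖a.toDist p.1 p.2‖ - ‖b.toDist p.1 p.2‖),
    sq_nonneg (‖a.toDist p.1 p.2‖), sq_nonneg (‖b.toDist p.1 p.2‖)]

theorem hasSum_inner_diag (a b : c.L2) : HasSum (fun p : ℤ × ℕ =>
    (((c.A (p.2 + p.1.toNat))⁻¹ : ℝ) : ℂ) * (diag b.toDist p.1 p.2 * conj (diag a.toDist p.1 p.2)))
    (inner ℂ a b) := by
  rw [inner_eq]
  exact diagEquiv.hasSum_iff.2 (summable_inner a b).hasSum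

theorem summable_inv_A_add (s : ℕ) : Summable fun t => (c.A (t + s))⁻¹ :=
  (summable_nat_add_iff s).2 c.summable_inv_A

theorem tsum_inv_A_add_le (s : ℕ) : ∑' t, (c.A (t + s))⁻¹ ≤ ∑' t, (c.A t)⁻¹ := by
  rw [← c.summable_inv_A.sum_add_tsum_nat_add s]
  exact le_add_of_nonneg_left (Finset.sum_nonneg fun _ _ => inv_A_nonneg _)

/-- The Cauchy–Schwarz inequality: on a diagonal the weight turns square summability into
summability. -/
theorem summable_and_tsum_sq_le {s : ℕ} {y : ℕ → ℂ}
    (h : Summable fun t => (c.A (t + s))⁻¹ * ‖y t‖ ^ 2) :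
    (Summable fun t => (c.A (t + s))⁻¹ * ‖y t‖) ∧
      (∑' t, (c.A (t + s))⁻¹ * ‖y t‖) ^ 2 ≤
        (∑' t, (c.A t)⁻¹) * ∑' t, (c.A (t + s))⁻¹ * ‖y t‖ ^ 2 := by
  have h0 : ∀ t, 0 ≤ (c.A (t + s))⁻¹ * ‖y t‖ := fun t =>
    mul_nonneg (inv_A_nonneg _) (norm_nonneg _)
  have h1 : ∀ t, 0 ≤ (c.A (t + s))⁻¹ * ‖y t‖ ^ 2 := fun t =>
    mul_nonneg (inv_A_nonneg _) (sq_nonneg _)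
  set M := (∑' t, (c.A t)⁻¹) * ∑' t, (c.A (t + s))⁻¹ * ‖y t‖ ^ 2
  have hM : 0 ≤ M := mul_nonneg (tsum_nonneg fun _ => inv_A_nonneg _) (tsum_nonneg h1)
  have h2 : ∀ u : Finset ℕ, ∑ t ∈ u, (c.A (t + s))⁻¹ * ‖y t‖ ≤ √M := by
    intro u
    refine Real.le_sqrt_of_sq_le ?_
    refine (Finset.sum_sq_le_sum_mul_sum_of_sq_le_mul u (f := fun t => (c.A (t + s))⁻¹)
      (g := fun t => (c.A (t + s))⁻¹ * ‖y t‖ ^ 2) (fun _ _ => inv_A_nonneg _) (fun t _ => h1 t)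
      fun t _ => le_of_eq (by ring)).trans ?_
    exact mul_le_mul
      (((summable_inv_A_add s).sum_le_tsum u fun _ _ => inv_A_nonneg _).trans
        (tsum_inv_A_add_le s))
      (h.sum_le_tsum u fun t _ => h1 t) (Finset.sum_nonneg fun t _ => h1 t)
      (tsum_nonneg fun _ => inv_A_nonneg _)
  have hs := summable_of_sum_le h0 h2
  refine ⟨hs, ?_⟩
  rw [← Real.sq_sqrt hM]
  exact pow_le_pow_left₀ (tsum_nonneg h0) (hs.tsum_le_of_sum_le h2) 2

/-- A family of diagonals with square summable supremum norms has finite norm, since the sum of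
the weights over each diagonal is bounded. -/
theorem mem_finiteNorm_of_bound {a : Distribution} {M : ℤ → ℝ} (hM : Summable M)
    (h : ∀ k t, ‖diag a k t‖ ^ 2 ≤ M k) : a ∈ c.finiteNorm := by
  have hM0 : ∀ k, 0 ≤ M k := fun k => (sq_nonneg _).trans (h k 0)
  rw [mem_finiteNorm_iff_diag]
  have hp : Summable fun p : ℤ × ℕ => M p.1 * (c.A p.2)⁻¹ :=
    hM.mul_of_nonneg c.summable_inv_A hM0 fun _ => inv_A_nonneg _
  have hinj : Function.Injective fun p : ℤ × ℕ => (p.1, p.2 + p.1.toNat) := by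
    rintro ⟨k, t⟩ ⟨k', t'⟩ h
    simp only [Prod.mk.injEq] at h ⊢
    obtain ⟨rfl, h⟩ := h
    exact ⟨rfl, by omega⟩
  refine Summable.of_nonneg_of_le (fun p => mul_nonneg (inv_A_nonneg _) (sq_nonneg _)) (fun p => ?_)
    (hp.comp_injective hinj)
  rw [mul_comm]
  exact mul_le_mul_of_nonneg_right (h p.1 p.2) (inv_A_nonneg _)

/-- The squared norm of the diagonal `k`. -/
def diagNormSq (c : Coefficients) (a : Distribution) (k : ℤ) : ℝ :=
  ∑' t, (c.A (t + k.toNat))⁻¹ * ‖diag a k t‖ ^ 2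

theorem summable_diag (a : c.L2) (k : ℤ) :
    Summable fun t => (c.A (t + k.toNat))⁻¹ * ‖diag a.toDist k t‖ ^ 2 :=
  ((mem_finiteNorm_iff_diag _).1 (toDist_mem a)).prod_factor k

theorem summable_diagNormSq (a : c.L2) : Summable (diagNormSq c a.toDist) :=
  ((mem_finiteNorm_iff_diag _).1 (toDist_mem a)).prod

/-! ### Boundary values on the maximal domains -/

theorem norm_diff_diag_D (a : Distribution) (k : ℤ) (t : ℕ) : ‖diff c k (diag a k) t‖ =
    (c.A (t + (k + 1).toNat))⁻¹ * ‖diag (D c.A c.B a) (k + 1) t‖ := by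
  rw [diag_D, norm_mul, Complex.norm_real, Real.norm_of_nonneg (c.A_pos _).le,
    inv_mul_cancel_left₀ (c.A_pos _).ne']

theorem norm_diff_diag_Dbar (a : Distribution) (k : ℤ) (t : ℕ) :
    ‖diff c (-k - 1) (diag a (k + 1)) t‖ =
      (c.A (t + k.toNat))⁻¹ * ‖diag (Dbar c.A c.B a) k t‖ := by
  rw [diag_Dbar, norm_neg, norm_mul, Complex.norm_real, Real.norm_of_nonneg (c.A_pos _).le,
    inv_mul_cancel_left₀ (c.A_pos _).ne']

/-- `D a`, as an element of the Hilbert space. -/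
def applyD {a : c.L2} (ha : a ∈ domMaxD c) : c.L2 :=
  .mk (D c.A c.B a.toDist) ((mem_domMaxD c a).1 ha)

theorem toDist_applyD {a : c.L2} (ha : a ∈ domMaxD c) :
    (applyD ha).toDist = D c.A c.B a.toDist := rfl

/-- `D̄ a`, as an element of the Hilbert space. -/
def applyDbar {a : c.L2} (ha : a ∈ domMaxDbar c) : c.L2 :=
  .mk (Dbar c.A c.B a.toDist) ((mem_domMaxDbar c a).1 ha)

theorem toDist_applyDbar {a : c.L2} (ha : a ∈ domMaxDbar c) :
    (applyDbar ha).toDist = Dbar c.A c.B a.toDist := rfl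

theorem summable_diff_D {a : c.L2} (ha : a ∈ domMaxD c) (k : ℤ) :
    (Summable fun t => ‖diff c k (diag a.toDist k) t‖) ∧
      (∑' t, ‖diff c k (diag a.toDist k) t‖) ^ 2 ≤
        (∑' t, (c.A t)⁻¹) * diagNormSq c (applyD ha).toDist (k + 1) := by
  simp only [norm_diff_diag_D]
  exact summable_and_tsum_sq_le (summable_diag (applyD ha) (k + 1))

theorem summable_diff_Dbar {a : c.L2} (ha : a ∈ domMaxDbar c) (k : ℤ) :
    (Summable fun t => ‖diff c (-k - 1) (diag a.toDist (k + 1)) t‖) ∧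
      (∑' t, ‖diff c (-k - 1) (diag a.toDist (k + 1)) t‖) ^ 2 ≤
        (∑' t, (c.A t)⁻¹) * diagNormSq c (applyDbar ha).toDist k := by
  simp only [norm_diff_diag_Dbar]
  exact summable_and_tsum_sq_le (summable_diag (applyDbar ha) k)

theorem exists_tendsto_diag_D {a : c.L2} (ha : a ∈ domMaxD c) :
    ∃ l : ℤ → ℂ, ∀ k, Tendsto (diag a.toDist k) atTop (𝓝 (l k)) := by
  choose l hl using fun k => exists_tendsto_of_diff (summable_diff_D ha k).1
  exact ⟨l, hl⟩

theorem exists_tendsto_diag_Dbar {a : c.L2} (ha : a ∈ domMaxDbar c) :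
    ∃ l : ℤ → ℂ, ∀ k, Tendsto (diag a.toDist k) atTop (𝓝 (l k)) := by
  choose l hl using fun k => exists_tendsto_of_diff (summable_diff_Dbar ha (k - 1)).1
  refine ⟨l, fun k => ?_⟩
  simpa only [sub_add_cancel] using hl k

theorem norm_le_of_tendsto {x : ℕ → ℂ} {l : ℂ} {C : ℝ} (h : Tendsto x atTop (𝓝 l))
    (hC : ∀ t, ‖x t‖ ≤ C) : ‖l‖ ≤ C :=
  le_of_tendsto h.norm (Eventually.of_forall hC)

/-- A boundary value exists as soon as all limits exist and are square summable outside a finite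
set of diagonals. -/
theorem exists_isBoundaryValue {a : Distribution} {l : ℤ → ℂ} {M : ℤ → ℝ} (s : Finset ℤ)
    (hl : ∀ k, Tendsto (diag a k) atTop (𝓝 (l k))) (hM : Summable M)
    (h : ∀ k, k ∉ s → ‖l k‖ ^ 2 ≤ M k) : ∃ φ, IsBoundaryValue a φ := by
  obtain ⟨φ, hφ⟩ := exists_fourierCoeff_eq (l := l) (by
    rw [← s.summable_compl_iff]
    exact Summable.of_nonneg_of_le (fun _ => sq_nonneg _) (fun k => h k k.2) (hM.subtype _))
  refine ⟨φ, (isBoundaryValue_iff a φ).2 fun k => ?_⟩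
  rw [hφ]
  exact hl k

/-- On the maximal domain of `D` the boundary condition only involves the vanishing limits: the
limits for `k < 0` are square summable by the estimate for the difference equation. -/
theorem mem_boundaryRan_iff {a : c.L2} (ha : a ∈ domMaxD c) (N : ℤ) :
    a ∈ boundaryRan c N ↔ ∀ k, N < k → Tendsto (diag a.toDist k) atTop (𝓝 0) := by
  constructor
  · rintro ⟨φ, hφ, hφ'⟩ k hk
    rw [← (mem_range_projN N φ).1 hφ' k hk]
    exact (isBoundaryValue_iff _ _).1 hφ k
  · intro h
    obtain ⟨l, hl⟩ := exists_tendsto_diag_D ha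
    have hM : Summable fun k => ((c.B 0)⁻¹) ^ 2 *
        ((∑' t, (c.A t)⁻¹) * diagNormSq c (applyD ha).toDist (k + 1)) :=
      (((Equiv.addRight (1 : ℤ)).summable_iff.2
        (summable_diagNormSq (applyD ha))).mul_left _).mul_left _
    -- Only the diagonals `0 ≤ k ≤ N` have neither the estimate nor a vanishing limit.
    obtain ⟨φ, hφ⟩ := exists_isBoundaryValue (Finset.Icc 0 N) hl hM fun k hk => by
      have hsq := mul_le_mul_of_nonneg_left (summable_diff_D ha k).2 (sq_nonneg (c.B 0)⁻¹)
      rcases lt_or_ge k 0 with hk0 | hk0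
      · rw [← mul_pow] at hsq
        exact (pow_le_pow_left₀ (norm_nonneg _) (norm_le_of_tendsto (hl k)
          (norm_le_of_diff hk0 (summable_diff_D ha k).1)) 2).trans hsq
      · have hkN : N < k := by
          rw [Finset.mem_Icc] at hk
          omega
        rw [tendsto_nhds_unique (hl k) (h k hkN), norm_zero, zero_pow two_ne_zero]
        exact (mul_nonneg (sq_nonneg _) (sq_nonneg _)).trans hsq
    refine ⟨φ, hφ, (mem_range_projN N φ).2 fun k hk => ?_⟩
    exact tendsto_nhds_unique ((isBoundaryValue_iff _ _).1 hφ k) (h k hk)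

/-- The analogue for `D̄`, where the limits with a positive index are square summable by the
estimate for the difference equation. -/
theorem mem_boundaryKer_iff {a : c.L2} (ha : a ∈ domMaxDbar c) (N : ℤ) :
    a ∈ boundaryKer c N ↔ ∀ k, k ≤ N → Tendsto (diag a.toDist (k + 1)) atTop (𝓝 0) := by
  constructor
  · rintro ⟨φ, hφ, hφ'⟩ k hk
    rw [← (mem_ker_projN N _).1 hφ' k hk, fourierCoeff_mulExpNeg]
    exact (isBoundaryValue_iff _ _).1 hφ (k + 1)
  · intro h
    obtain ⟨l, hl⟩ := exists_tendsto_diag_Dbar ha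
    have hM : Summable fun k => ((c.B 0)⁻¹) ^ 2 *
        ((∑' t, (c.A t)⁻¹) * diagNormSq c (applyDbar ha).toDist (k - 1)) :=
      (((Equiv.subRight (1 : ℤ)).summable_iff.2
        (summable_diagNormSq (applyDbar ha))).mul_left _).mul_left _
    obtain ⟨φ, hφ⟩ := exists_isBoundaryValue (Finset.Icc (N + 2) 0) hl hM fun k hk => by
      obtain ⟨k, rfl⟩ : ∃ j, k = j + 1 := ⟨k - 1, by ring⟩
      rw [add_sub_cancel_right]
      have hsq := mul_le_mul_of_nonneg_left (summable_diff_Dbar ha k).2 (sq_nonneg (c.B 0)⁻¹)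
      rcases lt_or_ge (-k - 1) 0 with hk0 | hk0
      · rw [← mul_pow] at hsq
        exact (pow_le_pow_left₀ (norm_nonneg _) (norm_le_of_tendsto (hl (k + 1))
          (norm_le_of_diff hk0 (summable_diff_Dbar ha k).1)) 2).trans hsq
      · have hkN : k ≤ N := by
          rw [Finset.mem_Icc] at hk
          omega
        rw [tendsto_nhds_unique (hl (k + 1)) (h k hkN), norm_zero, zero_pow two_ne_zero]
        exact (mul_nonneg (sq_nonneg _) (sq_nonneg _)).trans hsq
    refine ⟨φ, hφ, (mem_ker_projN N _).2 fun k hk => ?_⟩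
    rw [fourierCoeff_mulExpNeg]
    exact tendsto_nhds_unique ((isBoundaryValue_iff _ _).1 hφ (k + 1)) (h k hk)

/-! ### Green's formula -/

/-- Green's formula: the failure of `D` and `D̄` to be adjoint is the pairing
`∑ conj (r(a)_k) r(b)_{k+1}` of the boundary values. -/
theorem hasSum_boundary {a b : c.L2} (ha : a ∈ domMaxD c) (hb : b ∈ domMaxDbar c) {l l' : ℤ → ℂ}
    (hl : ∀ k, Tendsto (diag a.toDist k) atTop (𝓝 (l k)))
    (hl' : ∀ k, Tendsto (diag b.toDist k) atTop (𝓝 (l' k))) :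
    HasSum (fun k => conj (l k) * l' (k + 1))
      (inner ℂ a (applyDbar hb) - inner ℂ (applyD ha) b) := by
  have h1 := hasSum_inner_diag (applyD ha) b
  have h2 := hasSum_inner_diag a (applyDbar hb)
  have e1 : ∀ k t, (((c.A (t + (k + 1).toNat))⁻¹ : ℝ) : ℂ) *
      (diag b.toDist (k + 1) t * conj (diag (applyD ha).toDist (k + 1) t)) =
      diff c k (fun t => conj (diag a.toDist k t)) t * diag b.toDist (k + 1) t := by
    intro k t
    have := A_ne_zero (c := c) (t + (k + 1).toNat)
    rw [toDist_applyD, diag_D, map_mul, Complex.conj_ofReal, conj_diff]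
    push_cast
    field_simp
  have e2 : ∀ k t, (((c.A (t + k.toNat))⁻¹ : ℝ) : ℂ) *
      (diag (applyDbar hb).toDist k t * conj (diag a.toDist k t)) =
      -(conj (diag a.toDist k t) * diff c (-k - 1) (diag b.toDist (k + 1)) t) := by
    intro k t
    have := A_ne_zero (c := c) (t + k.toNat)
    rw [toDist_applyDbar, diag_Dbar]
    push_cast
    field_simp
  have s1 : ∀ k : ℤ, Summable fun t => diff c k (fun t => conj (diag a.toDist k t)) t *
      diag b.toDist (k + 1) t := fun k => by
    simpa only [e1] using h1.summable.prod_factor (k + 1)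
  have s2 : ∀ k : ℤ, Summable fun t => conj (diag a.toDist k t) *
      diff c (-k - 1) (diag b.toDist (k + 1)) t := fun k => by
    simpa only [e2, summable_neg_iff] using h2.summable.prod_factor k
  have h3 := (Equiv.addRight (1 : ℤ)).hasSum_iff.2
    (h1.prod_fiberwise fun k => (h1.summable.prod_factor k).hasSum)
  have h4 := h2.prod_fiberwise fun k => (h2.summable.prod_factor k).hasSum
  refine (funext fun k => ?_ : _ = fun k => conj (l k) * l' (k + 1)) ▸ h4.sub h3
  simp only [Function.comp_apply, Equiv.coe_addRight, e1, e2, tsum_neg]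
  have hconj : Tendsto (fun t => conj (diag a.toDist k t)) atTop (𝓝 (conj (l k))) :=
    (Complex.continuous_conj.tendsto _).comp (hl k)
  have := tsum_diff_mul_add (s1 k) (s2 k) hconj (hl' (k + 1))
  linear_combination -this

/-! ### Test elements -/

theorem diff_zero (k : ℤ) (t : ℕ) : diff c k (0 : ℕ → ℂ) t = 0 := by
  cases k with
  | ofNat m => simp [diff, fwd]
  | negSucc m => cases t <;> simp [diff, bwd]

theorem diag_ofDiag_single (k k' : ℤ) (x : ℕ → ℂ) :
    diag (ofDiag (Pi.single k x)) k' = if k' = k then x else 0 := by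
  funext t
  rw [diag_ofDiag]
  split_ifs with h
  · rw [h, Pi.single_eq_same]
  · rw [Pi.single_eq_of_ne h]

theorem ofDiag_single_mem {x : ℕ → ℂ} {C : ℝ} (hx : ∀ t, ‖x t‖ ≤ C) (k : ℤ) :
    ofDiag (Pi.single k x) ∈ c.finiteNorm := by
  refine mem_finiteNorm_of_bound (M := Pi.single k (C ^ 2))
    (summable_of_ne_finset_zero (s := {k}) fun k' hk' => ?_) fun k' t => ?_
  · exact Pi.single_eq_of_ne (by simpa using hk') _
  · rw [diag_ofDiag_single]
    split_ifs with h
    · rw [h, Pi.single_eq_same]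
      exact pow_le_pow_left₀ (norm_nonneg _) (hx t) 2
    · rw [Pi.single_eq_of_ne h]
      simp

theorem mem_finiteNorm_of_finite {a : Distribution} (s : Finset (ℤ × ℕ))
    (h : ∀ p, p ∉ s → diag a p.1 p.2 = 0) : a ∈ c.finiteNorm := by
  rw [mem_finiteNorm_iff_diag]
  refine summable_of_ne_finset_zero (s := s) fun p hp => ?_
  rw [h p hp, norm_zero, zero_pow two_ne_zero, mul_zero]

theorem tendsto_diag_ofDiag_single {k : ℤ} {x : ℕ → ℂ} (hx : Tendsto x atTop (𝓝 1)) (k' : ℤ) :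
    Tendsto (diag (ofDiag (Pi.single k x)) k') atTop (𝓝 (if k' = k then 1 else 0)) := by
  rw [diag_ofDiag_single]
  split_ifs with h
  · exact hx
  · exact tendsto_const_nhds

variable (c) in
/-- There is an element of the maximal domain of `D` with the boundary value `e^{ikφ}`. -/
theorem exists_domMaxD_test (k : ℤ) : ∃ a ∈ domMaxD c,
    ∀ k', Tendsto (diag a.toDist k') atTop (𝓝 (if k' = k then 1 else 0)) := by
  obtain ⟨x, C, hC, h0, h1⟩ := exists_diff_finite c k
  refine ⟨.mk _ (ofDiag_single_mem hC k), (mem_domMaxD c _).2 ?_, tendsto_diag_ofDiag_single h1⟩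
  refine mem_finiteNorm_of_finite {(k + 1, 0)} fun p hp => ?_
  obtain ⟨⟨j, t⟩, rfl⟩ : ∃ q : ℤ × ℕ, p = (q.1 + 1, q.2) := ⟨(p.1 - 1, p.2), by simp⟩
  rw [diag_D, toDist_mk, diag_ofDiag_single]
  split_ifs with h
  · subst h
    rw [h0 t (by simpa using hp), mul_zero]
  · rw [diff_zero, mul_zero]

variable (c) in
/-- There is an element of the maximal domain of `D̄` with the boundary value `e^{i(k+1)φ}`. -/
theorem exists_domMaxDbar_test (k : ℤ) : ∃ a ∈ domMaxDbar c,
    ∀ k', Tendsto (diag a.toDist k') atTop (𝓝 (if k' = k + 1 then 1 else 0)) := by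
  obtain ⟨x, C, hC, h0, h1⟩ := exists_diff_finite c (-k - 1)
  refine ⟨.mk _ (ofDiag_single_mem hC (k + 1)), (mem_domMaxDbar c _).2 ?_,
    tendsto_diag_ofDiag_single h1⟩
  refine mem_finiteNorm_of_finite {(k, 0)} fun p hp => ?_
  obtain ⟨j, t⟩ := p
  rw [diag_Dbar, toDist_mk, diag_ofDiag_single]
  split_ifs with h
  · obtain rfl : j = k := by omega
    rw [h0 t (by simpa using hp), mul_zero, neg_zero]
  · rw [diff_zero, mul_zero, neg_zero]

theorem single_mem_finiteNorm (i j : ℕ) : Matrix.single i j (1 : ℂ) ∈ c.finiteNorm := by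
  refine (c.mem_finiteNorm _).2 (summable_of_ne_finset_zero (s := {(i, j)}) fun p hp => ?_)
  rw [Matrix.single_apply_of_ne, norm_zero, zero_pow two_ne_zero, mul_zero]
  rintro ⟨h1, h2⟩
  exact hp (by rw [Finset.mem_singleton, h1, h2])

variable (c) in
/-- The matrix unit with the entry `1` in the place `(i, j)`. -/
def unit (i j : ℕ) : c.L2 := .mk (Matrix.single i j 1) (single_mem_finiteNorm i j)

theorem inner_unit (i j : ℕ) (a : c.L2) :
    inner ℂ (unit c i j) a = (((c.A i)⁻¹ : ℝ) : ℂ) * a.toDist i j := by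
  rw [inner_eq, tsum_eq_single (i, j)]
  · simp [unit]
  · intro p hp
    rw [unit, toDist_mk, Matrix.single_apply_of_ne, map_zero, mul_zero, mul_zero]
    rintro ⟨h1, h2⟩
    exact hp (by rw [h1, h2])

theorem continuous_toDist (i j : ℕ) : Continuous fun a : c.L2 => a.toDist i j := by
  have h : (fun a : c.L2 => a.toDist i j) = fun a => (c.A i : ℂ) * inner ℂ (unit c i j) a := by
    funext a
    rw [inner_unit, Complex.ofReal_inv, mul_inv_cancel_left₀ (A_ne_zero i)]
  rw [h]
  fun_prop

theorem toDist_unit (i j p q : ℕ) :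
    (unit c i j).toDist p q = if i = p ∧ j = q then 1 else 0 := by
  rw [unit, toDist_mk, Matrix.single_apply]

theorem D_unit_zero (i : ℕ) : D c.A c.B (unit c i 0).toDist =
    ((c.A (i + 1) * c.B i : ℂ) • unit c (i + 1) 0).toDist := by
  ext p q
  cases p with
  | zero => simp [D_zero_apply, toDist_unit]
  | succ p =>
    simp only [D_succ_apply, toDist_smul, Matrix.smul_apply, toDist_unit, smul_eq_mul]
    grind

theorem D_unit_succ (i j : ℕ) : D c.A c.B (unit c i (j + 1)).toDist =
    ((c.A (i + 1) * c.B i : ℂ) • unit c (i + 1) (j + 1) +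
      (-(c.A i * c.B j) : ℂ) • unit c i j).toDist := by
  ext p q
  cases p with
  | zero =>
    simp only [D_zero_apply, toDist_add, toDist_smul, Matrix.add_apply, Matrix.smul_apply,
      toDist_unit, smul_eq_mul]
    grind
  | succ p =>
    simp only [D_succ_apply, toDist_add, toDist_smul, Matrix.add_apply, Matrix.smul_apply,
      toDist_unit, smul_eq_mul]
    grind

theorem unit_mem_domMaxD (i j : ℕ) : unit c i j ∈ domMaxD c := by
  rw [mem_domMaxD]
  cases j with
  | zero => rw [D_unit_zero]; exact toDist_mem _
  | succ j => rw [D_unit_succ]; exact toDist_mem _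

/-- On matrix units the operators are adjoint to each other, without any assumption on `b`. -/
theorem inner_applyD_unit (i j : ℕ) (b : c.L2) :
    inner ℂ (applyD (unit_mem_domMaxD i j)) b =
      (((c.A i)⁻¹ : ℝ) : ℂ) * Dbar c.A c.B b.toDist i j := by
  have h1 := A_ne_zero (c := c) i
  have h2 := A_ne_zero (c := c) (i + 1)
  cases j with
  | zero =>
    rw [show applyD (unit_mem_domMaxD i 0) = _ from toDist_injective (D_unit_zero i),
      inner_smul_left, inner_unit, Dbar_apply_zero]
    simp only [map_mul, Complex.conj_ofReal, Complex.ofReal_inv]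
    field_simp
    ring
  | succ j =>
    rw [show applyD (unit_mem_domMaxD i (j + 1)) = _ from toDist_injective (D_unit_succ i j),
      inner_add_left, inner_smul_left, inner_smul_left, inner_unit, inner_unit, Dbar_apply_succ]
    simp only [map_mul, map_neg, Complex.conj_ofReal, Complex.ofReal_inv]
    field_simp
    ring

theorem tendsto_diag_unit (i j : ℕ) (k : ℤ) :
    Tendsto (diag (unit c i j).toDist k) atTop (𝓝 0) := by
  refine tendsto_const_nhds.congr' ?_
  filter_upwards [eventually_gt_atTop i] with t ht
  rw [diag, toDist_unit, if_neg (by omega)]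

theorem unit_mem_domain (N : ℤ) (i j : ℕ) : unit c i j ∈ (DPN c N).domain :=
  ⟨unit_mem_domMaxD i j,
    (mem_boundaryRan_iff (unit_mem_domMaxD i j) N).2 fun k _ => tendsto_diag_unit i j k⟩

variable (c) in
theorem dense_domain (N : ℤ) : Dense ((DPN c N).domain : Set c.L2) := by
  rw [Submodule.dense_iff_topologicalClosure_eq_top, Submodule.topologicalClosure_eq_top_iff,
    Submodule.eq_bot_iff]
  intro b hb
  refine toDist_injective ?_
  ext i j
  have := (Submodule.mem_orthogonal _ _).1 hb _ (unit_mem_domain N i j)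
  rw [inner_unit, mul_eq_zero, Complex.ofReal_inv,
    or_iff_right (inv_ne_zero (A_ne_zero i))] at this
  exact this

/-! ### Closedness and the adjoint -/

/-- Pairing with an element with the boundary value `e^{ikφ}` reads off a boundary coefficient. -/
theorem inner_sub_eq_of_test_left {k : ℤ} {a b : c.L2} (ha : a ∈ domMaxD c) (hb : b ∈ domMaxDbar c)
    (h : ∀ k', Tendsto (diag a.toDist k') atTop (𝓝 (if k' = k then 1 else 0))) {l : ℂ}
    (hl : Tendsto (diag b.toDist (k + 1)) atTop (𝓝 l)) :
    inner ℂ a (applyDbar hb) - inner ℂ (applyD ha) b = l := by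
  obtain ⟨l', hl'⟩ := exists_tendsto_diag_Dbar hb
  refine (hasSum_boundary ha hb h hl').unique ?_
  rw [tendsto_nhds_unique hl (hl' (k + 1))]
  convert hasSum_single k fun k' hk' => ?_ using 1
  · simp
  · simp [hk']

/-- Pairing with an element with the boundary value `e^{i(k+1)φ}` reads off a boundary
coefficient. -/
theorem inner_sub_eq_of_test_right {k : ℤ} {a b : c.L2} (ha : a ∈ domMaxD c) (hb : b ∈ domMaxDbar c)
    (h : ∀ k', Tendsto (diag b.toDist k') atTop (𝓝 (if k' = k + 1 then 1 else 0))) {l : ℂ}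
    (hl : Tendsto (diag a.toDist k) atTop (𝓝 l)) :
    inner ℂ a (applyDbar hb) - inner ℂ (applyD ha) b = conj l := by
  obtain ⟨l', hl'⟩ := exists_tendsto_diag_D ha
  refine (hasSum_boundary ha hb hl' h).unique ?_
  rw [tendsto_nhds_unique hl (hl' k)]
  convert hasSum_single k fun k' hk' => ?_ using 1
  · simp
  · simp [hk']

theorem DPN_apply {N : ℤ} (a : (DPN c N).domain) : DPN c N a = applyD a.2.1 := rfl

theorem continuous_D_apply (i j : ℕ) : Continuous fun a : c.L2 => D c.A c.B a.toDist i j := by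
  have h := fun i j => continuous_toDist (c := c) i j
  cases i with
  | zero => simp only [D_zero_apply]; fun_prop
  | succ i => simp only [D_succ_apply]; fun_prop

variable (c) in
/-- The graph of `D_{P_N}` is cut out by continuous equations: the equations `D a = b` between the
entries, and the vanishing of the boundary values, which by Green's formula is the equation
`(b, z) = (a, D̄ z)` for test elements `z`. -/
theorem isClosed_DPN (N : ℤ) : (DPN c N).IsClosed := by
  choose z hz hz' using exists_domMaxDbar_test c
  have hgraph : ((DPN c N).graph : Set (c.L2 × c.L2)) =
      {p | ∀ i j, D c.A c.B p.1.toDist i j = p.2.toDist i j} ∩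
        {p | ∀ k, N < k → inner ℂ p.1 (applyDbar (hz k)) = inner ℂ p.2 (z k)} := by
    ext ⟨a, b⟩
    simp only [SetLike.mem_coe, LinearPMap.mem_graph_iff]
    constructor
    · rintro ⟨a, rfl, rfl⟩
      refine ⟨fun i j => rfl, fun k hk => ?_⟩
      have := inner_sub_eq_of_test_right a.2.1 (hz k) (hz' k)
        ((mem_boundaryRan_iff a.2.1 N).1 a.2.2 k hk)
      rwa [map_zero, sub_eq_zero] at this
    · rintro ⟨h1, h2⟩
      have h3 : D c.A c.B a.toDist = b.toDist := Matrix.ext h1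
      have ha : a ∈ domMaxD c := by
        rw [mem_domMaxD, h3]
        exact toDist_mem b
      have hb : applyD ha = b := toDist_injective h3
      refine ⟨⟨a, ha, (mem_boundaryRan_iff ha N).2 fun k hk => ?_⟩, rfl, hb⟩
      obtain ⟨l, hl⟩ := exists_tendsto_diag_D ha
      have := inner_sub_eq_of_test_right ha (hz k) (hz' k) (hl k)
      rw [hb, sub_eq_zero.2 (h2 k hk), eq_comm, map_eq_zero] at this
      rw [← this]
      exact hl k
  rw [LinearPMap.IsClosed, hgraph]
  refine IsClosed.inter ?_ ?_
  · simp only [Set.ofPred_forall]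
    exact isClosed_iInter fun i => isClosed_iInter fun j => isClosed_eq
      ((continuous_D_apply i j).comp continuous_fst) ((continuous_toDist i j).comp continuous_snd)
  · simp only [Set.ofPred_forall]
    exact isClosed_iInter fun k => isClosed_iInter fun _ => isClosed_eq
      (continuous_fst.inner continuous_const) (continuous_snd.inner continuous_const)

/-- Each term of the boundary pairing vanishes: `r(a)_k` for `k > N`, and `r(b)_{k+1}` for
`k ≤ N`. -/
theorem isFormalAdjoint (N : ℤ) : (DPN c N).IsFormalAdjoint (DbarPN c N) := by
  intro a b
  obtain ⟨l, hl⟩ := exists_tendsto_diag_D a.2.1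
  obtain ⟨l', hl'⟩ := exists_tendsto_diag_Dbar b.2.1
  have h := hasSum_boundary a.2.1 b.2.1 hl hl'
  have h0 : ∀ k, conj (l k) * l' (k + 1) = 0 := by
    intro k
    rcases lt_or_ge N k with hk | hk
    · rw [tendsto_nhds_unique (hl k) ((mem_boundaryRan_iff a.2.1 N).1 a.2.2 k hk), map_zero,
        zero_mul]
    · rw [tendsto_nhds_unique (hl' (k + 1)) ((mem_boundaryKer_iff b.2.1 N).1 b.2.2 k hk), mul_zero]
  simp only [h0] at h
  exact (sub_eq_zero.1 (h.unique hasSum_zero)).symm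

variable (c) in
/-- Pairing with the matrix units identifies the adjoint with `D̄` in the sense of distributions;
pairing with test elements in the domain of `D_{P_N}` gives the boundary condition. -/
theorem adjoint_DPN (N : ℤ) : (DPN c N).adjoint = DbarPN c N := by
  have hd := dense_domain c N
  have hle := (isFormalAdjoint (c := c) N).le_adjoint hd
  refine (LinearPMap.eq_of_le_of_domain_eq hle (le_antisymm hle.1 fun b hb => ?_)).symm
  have hadj : ∀ a : (DPN c N).domain, inner ℂ (DPN c N a) b =
      inner ℂ (a : c.L2) ((DPN c N).adjoint ⟨b, hb⟩) :=
    fun a => (LinearPMap.adjoint_isFormalAdjoint hd).symm a ⟨b, hb⟩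
  have hD : Dbar c.A c.B b.toDist = ((DPN c N).adjoint ⟨b, hb⟩).toDist := by
    ext i j
    have h := hadj ⟨unit c i j, unit_mem_domain N i j⟩
    rw [DPN_apply, inner_applyD_unit, inner_unit, Complex.ofReal_inv] at h
    exact mul_left_cancel₀ (inv_ne_zero (A_ne_zero i)) h
  have hmem : b ∈ domMaxDbar c := by
    rw [mem_domMaxDbar, hD]
    exact toDist_mem _
  refine ⟨hmem, (mem_boundaryKer_iff hmem N).2 fun k hk => ?_⟩
  obtain ⟨a, ha, hl⟩ := exists_domMaxD_test c k
  obtain ⟨l', hl'⟩ := exists_tendsto_diag_Dbar hmem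
  have ha' : a ∈ boundaryRan c N := (mem_boundaryRan_iff ha N).2 fun k' hk' => by
    simpa [(show k' ≠ k by omega)] using hl k'
  have h := inner_sub_eq_of_test_left ha hmem hl (hl' (k + 1))
  have h' := hadj ⟨a, ha, ha'⟩
  rw [DPN_apply] at h'
  rw [h', show applyDbar hmem = _ from toDist_injective hD, sub_self] at h
  rw [h]
  exact hl' (k + 1)

/-! ### The kernel -/

theorem diff_eq_zero_of_D_eq_zero {a : Distribution} (h : D c.A c.B a = 0) (k : ℤ) (t : ℕ) :
    diff c k (diag a k) t = 0 := by
  have := diag_D c a k t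
  rw [h, eq_comm] at this
  exact (mul_eq_zero.1 this).resolve_left (A_ne_zero _)

variable (c) in
/-- The entries `a_{n0}`, `0 ≤ n ≤ N`, as coordinates on the kernel of `D_{P_N}`. -/
def kerCoord (N : ℤ) : LinearMap.ker (DPN c N).toFun →ₗ[ℂ] (Fin (N + 1).toNat → ℂ) where
  toFun a n := ((a : (DPN c N).domain) : c.L2).toDist n 0
  map_add' _ _ := rfl
  map_smul' _ _ := rfl

theorem kerCoord_injective (N : ℤ) : Function.Injective (kerCoord c N) := by
  rw [injective_iff_map_eq_zero]
  rintro ⟨a, ha⟩ h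
  have hD : D c.A c.B (a : c.L2).toDist = 0 := congr_arg Coefficients.L2.toDist ha
  have h0 := diff_eq_zero_of_D_eq_zero hD
  refine Subtype.ext (Subtype.ext (toDist_injective (ext_diag fun k t => ?_)))
  change diag (a : c.L2).toDist k t = 0
  cases k with
  | ofNat m =>
    have h1 := eq_of_fwd_eq_zero (c := c) (h0 (Int.ofNat m))
    suffices h2 : diag (a : c.L2).toDist (Int.ofNat m) 0 = 0 by
      rw [h1 t, h2, zero_div, zero_mul]
    rcases lt_or_ge N m with hm | hm
    · have h2 := (mem_boundaryRan_iff a.2.1 N).1 a.2.2 m hm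
      have h3 := ((tendsto_weight_ofReal c m).const_mul
        (diag (a : c.L2).toDist (Int.ofNat m) 0 / weight c m 0)).congr fun t => (h1 t).symm
      have h4 := tendsto_nhds_unique h3 h2
      rw [mul_one, div_eq_zero_iff] at h4
      exact h4.resolve_right (weight_ne_zero c m 0)
    · have h2 : (a : c.L2).toDist m 0 = 0 := congr_fun h ⟨m, by omega⟩
      simpa [diag] using h2
  | negSucc m =>
    have h1 := norm_le_of_diff (c := c) (Int.negSucc_lt_zero m)
      (x := diag (a : c.L2).toDist (Int.negSucc m))
      (by simp only [h0, norm_zero]; exact summable_zero) t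
    simp only [h0, norm_zero, tsum_zero, mul_zero] at h1
    exact norm_le_zero_iff.1 h1

theorem kerCoord_surjective (N : ℤ) : Function.Surjective (kerCoord c N) := by
  intro v
  set z : ℤ → ℂ := fun k => if h : 0 ≤ k ∧ k ≤ N then
    v ⟨k.toNat, by omega⟩ / weight c k.toNat 0 else 0 with hz
  have hz0 : ∀ k, ¬ (0 ≤ k ∧ k ≤ N) → z k = 0 := fun k hk => dif_neg hk
  set a : Distribution := ofDiag fun k t => z k * weight c k.toNat t with ha
  have hdiag : ∀ k, diag a k = fun t => z k * weight c k.toNat t := fun k =>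
    funext fun t => diag_ofDiag _ k t
  have hmem : a ∈ c.finiteNorm := by
    refine mem_finiteNorm_of_bound (M := fun k => ‖z k‖ ^ 2)
      (summable_of_ne_finset_zero (s := Finset.Icc 0 N) fun k hk => ?_) fun k t => ?_
    · rw [hz0 k (by simpa only [Finset.mem_Icc] using hk), norm_zero, zero_pow two_ne_zero]
    · rw [hdiag, norm_mul, norm_weight]
      exact pow_le_pow_left₀ (mul_nonneg (norm_nonneg _) (weight_pos c _ _).le)
        (mul_le_of_le_one_right (norm_nonneg _) (weight_le_one c _ _)) 2
  have hD : D c.A c.B a = 0 := by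
    refine ext_diag fun k t => ?_
    obtain ⟨k, rfl⟩ : ∃ j, k = j + 1 := ⟨k - 1, by ring⟩
    rw [diag_D, hdiag]
    refine mul_eq_zero_of_right _ ?_
    cases k with
    | ofNat m =>
      change fwd c m (fun t => z m * (weight c m t : ℂ)) t = 0
      rw [fwd_const_mul, fwd_weight, Pi.zero_apply, mul_zero]
    | negSucc m =>
      rw [hz0 _ fun h => absurd h.1 (by simp)]
      simp only [zero_mul]
      exact diff_zero _ t
  have hdom : Coefficients.L2.mk a hmem ∈ domMaxD c := by
    rw [mem_domMaxD, toDist_mk, hD]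
    exact zero_mem _
  refine ⟨⟨⟨.mk a hmem, hdom, (mem_boundaryRan_iff hdom N).2 fun k hk => ?_⟩,
    toDist_injective hD⟩, funext fun n => ?_⟩
  · rw [toDist_mk, hdiag, hz0 k (by omega)]
    simp only [zero_mul]
    exact tendsto_const_nhds
  · have h1 : z (n : ℕ) = v n / weight c n 0 := dif_pos (by omega)
    have h2 := congr_fun (hdiag (n : ℕ)) 0
    simp only [h1, Int.toNat_natCast] at h2
    rw [div_mul_cancel₀ _ (weight_ne_zero c n 0)] at h2
    rw [← h2]
    change a n 0 = _
    simp [diag]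

/-! ### The range -/

/-- The equation `D a = b` has a solution whose boundary value has no coefficients with an index
`k ≥ 0`. -/
theorem exists_applyD_eq (b : c.L2) : ∃ a, ∃ ha : a ∈ domMaxD c, applyD ha = b ∧
    ∀ k : ℤ, 0 ≤ k → Tendsto (diag a.toDist k) atTop (𝓝 0) := by
  have hcs := fun k : ℤ => summable_and_tsum_sq_le (summable_diag b (k + 1))
  set y : ℤ → ℕ → ℂ := fun k t =>
    (c.A (t + (k + 1).toNat) : ℂ)⁻¹ * diag b.toDist (k + 1) t with hy
  have hny : ∀ k t, ‖y k t‖ = (c.A (t + (k + 1).toNat))⁻¹ * ‖diag b.toDist (k + 1) t‖ := by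
    intro k t
    rw [hy, norm_mul, norm_inv, Complex.norm_real, Real.norm_of_nonneg (c.A_pos _).le]
  simp only [← hny] at hcs
  choose x hx hxb hx0 using fun k => exists_diff_eq (c := c) k (hcs k).1
  have hdiag : ∀ k, diag (ofDiag x) k = x k := fun k => funext (diag_ofDiag x k)
  have hmem : ofDiag x ∈ c.finiteNorm := by
    refine mem_finiteNorm_of_bound (M := fun k => ((c.B 0)⁻¹) ^ 2 *
        ((∑' t, (c.A t)⁻¹) * diagNormSq c b.toDist (k + 1)))
      ((((Equiv.addRight (1 : ℤ)).summable_iff.2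
        (summable_diagNormSq b)).mul_left _).mul_left _) fun k t => ?_
    rw [hdiag]
    refine (pow_le_pow_left₀ (norm_nonneg _) (hxb k t) 2).trans ?_
    rw [mul_pow]
    exact mul_le_mul_of_nonneg_left (hcs k).2 (sq_nonneg _)
  have hD : D c.A c.B (ofDiag x) = b.toDist := by
    refine ext_diag fun k t => ?_
    obtain ⟨k, rfl⟩ : ∃ j, k = j + 1 := ⟨k - 1, by ring⟩
    rw [diag_D, hdiag, hx, hy]
    exact mul_inv_cancel_left₀ (A_ne_zero _) _
  have hdom : Coefficients.L2.mk _ hmem ∈ domMaxD c := by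
    rw [mem_domMaxD, toDist_mk, hD]
    exact toDist_mem b
  refine ⟨_, hdom, toDist_injective hD, fun k hk => ?_⟩
  rw [toDist_mk, hdiag]
  exact hx0 k hk

theorem norm_weight_le_one (m t : ℕ) : ‖((weight c m t : ℝ) : ℂ)‖ ≤ 1 := by
  rw [norm_weight]
  exact weight_le_one c m t

variable (c) in
/-- An element of the kernel of `D̄` with the boundary value `e^{-imφ}`. The range of `D_{P_N}` is
the orthogonal complement of these elements for `0 ≤ m < -N - 1`. -/
def kerDbar (m : ℕ) : c.L2 :=
  .mk (ofDiag (Pi.single (-(m : ℤ)) fun t => (weight c m t : ℂ)))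
    (ofDiag_single_mem (norm_weight_le_one m) _)

theorem Dbar_kerDbar (m : ℕ) : Dbar c.A c.B (kerDbar c m).toDist = 0 := by
  refine ext_diag fun k t => ?_
  rw [diag_Dbar, kerDbar, toDist_mk, diag_ofDiag_single]
  split_ifs with h
  · rw [show -k - 1 = Int.ofNat m by rw [Int.ofNat_eq_natCast]; omega, diff, fwd_weight,
      Pi.zero_apply, mul_zero, neg_zero]
    rfl
  · rw [diff_zero, mul_zero, neg_zero]
    rfl

theorem kerDbar_mem (m : ℕ) : kerDbar c m ∈ domMaxDbar c := by
  rw [mem_domMaxDbar, Dbar_kerDbar]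
  exact zero_mem _

theorem tendsto_diag_neg {a : c.L2} (ha : a ∈ domMaxD c) (m : ℕ) :
    Tendsto (diag a.toDist (-(m : ℤ) - 1)) atTop (𝓝 (-inner ℂ (kerDbar c m) (applyD ha))) := by
  obtain ⟨l, hl⟩ := exists_tendsto_diag_D ha
  have h := inner_sub_eq_of_test_right (k := -(m : ℤ) - 1) ha (kerDbar_mem m)
    (fun k' => by
      rw [sub_add_cancel]
      exact tendsto_diag_ofDiag_single (tendsto_weight_ofReal c m) k') (hl _)
  rw [show applyDbar (kerDbar_mem m) = 0 from toDist_injective (Dbar_kerDbar m), inner_zero_right,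
    zero_sub] at h
  have h' := congr_arg conj h
  rw [Complex.conj_conj, map_neg, inner_conj_symm] at h'
  rw [h']
  exact hl _

variable (c) in
/-- The pairings with the elements of the kernel of the adjoint of `D_{P_N}`. -/
def rangeFunctional (N : ℤ) : c.L2 →L[ℂ] (Fin (-N - 1).toNat → ℂ) :=
  ContinuousLinearMap.pi fun m => innerSL ℂ (kerDbar c m)

theorem range_DPN (N : ℤ) :
    LinearMap.range (DPN c N).toFun = LinearMap.ker (rangeFunctional c N).toLinearMap := by
  ext b
  simp only [LinearMap.mem_range, LinearMap.mem_ker]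
  constructor
  · rintro ⟨a, rfl⟩
    funext m
    have h := tendsto_nhds_unique (tendsto_diag_neg a.2.1 m)
      ((mem_boundaryRan_iff a.2.1 N).1 a.2.2 _ (by omega))
    exact neg_eq_zero.1 h
  · intro h
    obtain ⟨a, ha, hb, h0⟩ := exists_applyD_eq b
    refine ⟨⟨a, ha, (mem_boundaryRan_iff ha N).2 fun k hk => ?_⟩, hb⟩
    rcases le_or_gt 0 k with hk0 | hk0
    · exact h0 k hk0
    · obtain ⟨m, rfl⟩ : ∃ m : ℕ, k = -(m : ℤ) - 1 := ⟨(-k - 1).toNat, by omega⟩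
      have h1 := tendsto_diag_neg ha m
      have h2 : inner ℂ (kerDbar c m) b = 0 := congr_fun h ⟨m, by omega⟩
      rwa [hb, h2, neg_zero] at h1

theorem inner_kerDbar_unit (m n : ℕ) : inner ℂ (kerDbar c m) (unit c 0 n) =
    if n = m then (c.A 0 : ℂ)⁻¹ * weight c m 0 else 0 := by
  rw [← inner_conj_symm, inner_unit, kerDbar, toDist_mk, ofDiag]
  split_ifs with h
  · subst h
    simp
  · rw [Pi.single_eq_of_ne (by simpa using h)]
    simp

theorem rangeFunctional_surjective (N : ℤ) :
    Function.Surjective (rangeFunctional c N).toLinearMap := by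
  intro v
  refine ⟨∑ n, (v n * (c.A 0 / weight c n 0)) • unit c 0 n, funext fun m => ?_⟩
  change inner ℂ (kerDbar c m) _ = _
  rw [inner_sum, Finset.sum_eq_single m]
  · have h1 := A_ne_zero (c := c) 0
    have h2 := weight_ne_zero c m 0
    rw [inner_smul_right, inner_kerDbar_unit, if_pos rfl]
    field_simp
  · intro n _ hn
    rw [inner_smul_right, inner_kerDbar_unit, if_neg (Fin.val_ne_of_ne hn), mul_zero]
  · exact fun h => absurd (Finset.mem_univ m) h

variable (c) in
/-- The kernel of `D_{P_N}` has the dimension `max (N + 1) 0`. -/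
def kerEquiv (N : ℤ) : LinearMap.ker (DPN c N).toFun ≃ₗ[ℂ] (Fin (N + 1).toNat → ℂ) :=
  LinearEquiv.ofBijective (kerCoord c N) ⟨kerCoord_injective N, kerCoord_surjective N⟩

variable (c) in
/-- The cokernel of `D_{P_N}` has the dimension `max (-N - 1) 0`. -/
def cokerEquiv (N : ℤ) :
    (c.L2 ⧸ LinearMap.range (DPN c N).toFun) ≃ₗ[ℂ] (Fin (-N - 1).toNat → ℂ) :=
  (Submodule.quotEquivOfEq _ _ (range_DPN N)).trans
    ((rangeFunctional c N).toLinearMap.quotKerEquivOfSurjective (rangeFunctional_surjective N))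

theorem isFredholm_DPN (N : ℤ) : IsFredholm (DPN c N) where
  dense_domain := dense_domain c N
  isClosed := isClosed_DPN c N
  finite_ker := (kerEquiv c N).symm.finiteDimensional
  isClosed_range := by
    rw [range_DPN]
    exact (rangeFunctional c N).isClosed_ker
  finite_coker := (cokerEquiv c N).symm.finiteDimensional

theorem index_DPN (N : ℤ) : index (DPN c N) = N + 1 := by
  rw [index, (kerEquiv c N).finrank_eq, (cokerEquiv c N).finrank_eq, Module.finrank_fin_fun,
    Module.finrank_fin_fun]
  omega

end QuantumDisk

end

theorem theorem3 (c : QuantumDisk.Coefficients) (N : ℤ) :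
    QuantumDisk.IsFredholm (QuantumDisk.DPN c N) ∧
      (QuantumDisk.DPN c N).adjoint = QuantumDisk.DbarPN c N ∧
      QuantumDisk.index (QuantumDisk.DPN c N) = N + 1 :=
  ⟨QuantumDisk.isFredholm_DPN N, QuantumDisk.adjoint_DPN c N, QuantumDisk.index_DPN N⟩
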